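/- Let $n\ge 2$, $N\ge 4$, let $\Omega\subset\mathbb R^n$ be open and bounded, and let $2\le p<q<N$. Write $B^N_{1/2}=\{a\in\mathbb R^N:|a|<1/2\}$ and equip $\mathbb R^{N\times n}$ with the Euclidean (Frobenius) norm. Let $f:\Omega\times\mathbb R^{N\times n}\to\mathbb R$ be a Carathéodory function such that, for some constants $1\le C<\infty$, $0\le\mu\le1$, $0<\sigma\le1$ and for all $x,x_1,x_2\in\Omega$ and $\zeta,\zeta_1,\zeta_2\in\mathbb R^{N\times n}$, with $f'=D_\zeta f$: (H1) $\zeta\mapsto f(x,\zeta)$ is of class $C^1$; (H2) $|\zeta|^p\le f(x,\zeta)\le C(|\zeta|^q+1)$; (H3) $C^{-1}(\mu^2+|\zeta_1|^2+|\zeta_2|^2)^{\frac{p-2}{2}}|\zeta_1-\zeta_2|^2\le\langle f'(x,\zeta_1)-f'(x,\zeta_2),\zeta_1-\zeta_2\rangle$; (H4) $|f'(x_1,\zeta)-f'(x_2,\zeta)|\le C|x_1-x_2|^\sigma(1+|\zeta|^{q-1})$; (H5) there is a constant $K>0$ such that for every $v\in W^{1,p}_{\rm loc}(\Omega,\mathbb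 R^N)$, with $w^a(x)=\frac{v(x)-a}{|v(x)-a|}$ for $a\in B^N_{1/2}$ and with $Dw^a$ the weak gradient in $x$ (taken jointly measurable in $(x,a)$), one has $$\int_{B^N_{1/2}}f(x,Dw^a(x))\,da\le K\,(f(x,Dv(x))+1)\qquad\text{for a.e. }x\in\Omega .$$ For $s\ge1$ and an open ball $B$ let $W^{1,s}(B,\mathbb S^{N-1})$ be the set of $u\in W^{1,s}(B,\mathbb R^N)$ with $|u(x)|=1$ for a.e. $x\in B$. Let $B_R=B_R(x_0)$, $R>0$, be an open ball with closure contained in $\Omega$, let $u\in W^{1,p}(B_R,\mathbb S^{N-1})$, and let $(u_j)_{j\in\mathbb N}\subset W^{1,q}(B_R,\mathbb R^N)$ satisfy $$u_j\to u\ \text{strongly in }W^{1,p}(B_R,\mathbb R^N),\qquad f(\cdot,Du_j)\to f(\cdot,Du)\ \text{in }L^1(B_R).$$ Then there is a sequence $(\bar v_j)_{j\in\mathbb N}\subset W^{1,q}(B_R,\mathbb S^{N-1})$ such that $$\bar v_j\to u\ \text{strongly in }W^{1,p}(B_R,\mathbb R^N),\qquad f(\cdot,D\bar v_j)\to f(\cdot,Du)\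 \text{in }L^1(B_R).$$ -/

import Mathlib

open MeasureTheory Filter Topology
open scoped ContDiff ENNReal

/-- `ℝ^m` with the Euclidean norm. -/
abbrev Euc (m : ℕ) : Type := EuclideanSpace ℝ (Fin m)

/-- `ℝ^{N × n}` with the Frobenius norm; the entry `(i, k)` of a gradient is `∂ₖ uᵢ`. -/
abbrev EucMat (N n : ℕ) : Type := EuclideanSpace ℝ (Fin N × Fin n)

/-- `Du` is a weak (distributional) gradient of `u` on the open set `U`. -/
def HasWeakGrad {n N : ℕ} (U : Set (Euc n)) (u : Euc n → Euc N) (Du : Euc n → EucMat N n) :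
    Prop :=
  LocallyIntegrableOn u U volume ∧ LocallyIntegrableOn Du U volume ∧
    ∀ φ : Euc n → ℝ, ContDiff ℝ ∞ φ → HasCompactSupport φ → tsupport φ ⊆ U →
      ∀ (i : Fin N) (k : Fin n),
        ∫ x in U, fderiv ℝ φ x (EuclideanSpace.single k 1) * u x i
          = - ∫ x in U, φ x * Du x (i, k)

/-- `u ∈ W^{1,p}(U, ℝ^N)`, with weak gradient `Du`. -/
def MemW1p {n N : ℕ} (p : ℝ) (U : Set (Euc n)) (u : Euc n → Euc N)
    (Du : Euc n → EucMat N n) : Prop :=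
  MemLp u (ENNReal.ofReal p) (volume.restrict U) ∧
    MemLp Du (ENNReal.ofReal p) (volume.restrict U) ∧ HasWeakGrad U u Du

/-- `u ∈ W^{1,p}_loc(U, ℝ^N)`, with weak gradient `Du`. -/
def MemW1pLoc {n N : ℕ} (p : ℝ) (U : Set (Euc n)) (u : Euc n → Euc N)
    (Du : Euc n → EucMat N n) : Prop :=
  ∀ V : Set (Euc n), IsOpen V → IsCompact (closure V) → closure V ⊆ U → MemW1p p V u Du

/-- `u ∈ W^{1,p}(U, S^{N-1})`, with weak gradient `Du`. -/
def MemW1pSphere {n N : ℕ} (p : ℝ) (U : Set (Euc n)) (u : Euc n → Euc N)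
    (Du : Euc n → EucMat N n) : Prop :=
  MemW1p p U u Du ∧ ∀ᵐ x ∂(volume.restrict U), u x ∈ Metric.sphere (0 : Euc N) 1

/-- Strong convergence in `W^{1,p}(U, ℝ^N)` of maps `uj j` with weak gradients `Duj j`
to `u` with weak gradient `Du`. -/
def TendstoW1p {n N : ℕ} (p : ℝ) (U : Set (Euc n)) (uj : ℕ → Euc n → Euc N)
    (Duj : ℕ → Euc n → EucMat N n) (u : Euc n → Euc N) (Du : Euc n → EucMat N n) : Prop :=
  (∀ j, MemW1p p U (uj j) (Duj j)) ∧ MemW1p p U u Du ∧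
    Tendsto (fun j => eLpNorm (uj j - u) (ENNReal.ofReal p) (volume.restrict U)) atTop (𝓝 0) ∧
    Tendsto (fun j => eLpNorm (Duj j - Du) (ENNReal.ofReal p) (volume.restrict U)) atTop (𝓝 0)

/-- Convergence in `L^1(U)`. -/
def TendstoL1 {n : ℕ} (U : Set (Euc n)) (Fj : ℕ → Euc n → ℝ) (F : Euc n → ℝ) : Prop :=
  (∀ j, IntegrableOn (Fj j) U volume) ∧ IntegrableOn F U volume ∧
    Tendsto (fun j => eLpNorm (Fj j - F) 1 (volume.restrict U)) atTop (𝓝 0)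

/-- The map `x ↦ (v x - a) / |v x - a|`. -/
noncomputable def radialProj {n N : ℕ} (v : Euc n → Euc N) (a : Euc N) : Euc n → Euc N :=
  fun x => ‖v x - a‖⁻¹ • (v x - a)

/-- `f` is a Carathéodory integrand on `Ω × ℝ^{N × n}`. -/
def IsCaratheodory {n N : ℕ} (Ω : Set (Euc n)) (f : Euc n → EucMat N n → ℝ) : Prop :=
  (∀ ζ, AEStronglyMeasurable (fun x => f x ζ) (volume.restrict Ω)) ∧
    ∀ x ∈ Ω, Continuous (f x)

/-- The averaged projection condition: with one constant `K`, for every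
`v ∈ W^{1,p}_loc(Ω, ℝ^N)` the family `w^a = (v - a) / |v - a|` satisfies
`∫_{B_{1/2}} f(x, D w^a(x)) da ≤ K (f(x, Dv(x)) + 1)` for a.e. `x ∈ Ω`. Here `D w^a` is the weak
gradient of `w^a` (for a.e. `a`), taken jointly measurable in `(x, a)` so that the integral over
`a` makes sense for a.e. `x`; it does not depend on the choice of such a representative. -/
def AveragedProjectionBound {n N : ℕ} (p : ℝ) (Ω : Set (Euc n))
    (f : Euc n → EucMat N n → ℝ) : Prop :=
  ∃ K : ℝ, 0 < K ∧
    ∀ (v : Euc n → Euc N) (Dv : Euc n → EucMat N n), MemW1pLoc p Ω v Dv →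
      ∀ Dw : Euc N → Euc n → EucMat N n,
        AEStronglyMeasurable (fun z : Euc n × Euc N => Dw z.2 z.1)
          ((volume.restrict Ω).prod (volume.restrict (Metric.ball (0 : Euc N) (1 / 2)))) →
        (∀ᵐ a ∂(volume.restrict (Metric.ball (0 : Euc N) (1 / 2))),
          HasWeakGrad Ω (radialProj v a) (Dw a)) →
        ∀ᵐ x ∂(volume.restrict Ω),
          ∫⁻ a in Metric.ball (0 : Euc N) (1 / 2), ENNReal.ofReal (f x (Dw a x))
            ≤ ENNReal.ofReal (K * (f x (Dv x) + 1))

/-- The standing assumptions on the integrand: `(p, q)`-growth, strong convexity, Hölder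
dependence on `x`, and the averaged projection condition. The derivative `f'(x, ζ)` in `ζ` is
`gradient (f x) ζ`, with respect to the Frobenius inner product. -/
structure IntegrandAssumptions {n N : ℕ} (p q C μ σ : ℝ) (Ω : Set (Euc n))
    (f : Euc n → EucMat N n → ℝ) : Prop where
  one_le_C : 1 ≤ C
  mu_nonneg : 0 ≤ μ
  mu_le_one : μ ≤ 1
  sigma_pos : 0 < σ
  sigma_le_one : σ ≤ 1
  caratheodory : IsCaratheodory Ω f
  contDiff : ∀ x ∈ Ω, ContDiff ℝ 1 (f x)
  lower_growth : ∀ x ∈ Ω, ∀ ζ, ‖ζ‖ ^ p ≤ f x ζ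
  upper_growth : ∀ x ∈ Ω, ∀ ζ, f x ζ ≤ C * (‖ζ‖ ^ q + 1)
  strongly_monotone : ∀ x ∈ Ω, ∀ ζ₁ ζ₂ : EucMat N n,
    C⁻¹ * (μ ^ 2 + ‖ζ₁‖ ^ 2 + ‖ζ₂‖ ^ 2) ^ ((p - 2) / 2) * ‖ζ₁ - ζ₂‖ ^ 2
      ≤ inner ℝ (gradient (f x) ζ₁ - gradient (f x) ζ₂) (ζ₁ - ζ₂)
  holder : ∀ x₁ ∈ Ω, ∀ x₂ ∈ Ω, ∀ ζ,
    ‖gradient (f x₁) ζ - gradient (f x₂) ζ‖ ≤ C * ‖x₁ - x₂‖ ^ σ * (1 + ‖ζ‖ ^ (q - 1))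
  averaged_projection : AveragedProjectionBound p Ω f

/-! For a centre `a` near the origin, the radial projection `w_j^a = (u_j - a)/|u_j - a|` is
sphere-valued and should be close to `u`: projecting `u` itself from `0` changes nothing. Measure
closeness by the integral over the ball of the deviation `|w - u|^p + |Dw - Du|^p + |f(x,Dw) -
f(x,Du)|`. It suffices to find, for each `ε > 0`, one pair `(j, a)` with deviation below `ε`, such
that `w_j^a` lies in `W^{1,q}`.

The selection averages over `a` in a small ball `B_ρ`. By (H5) the averaged deviation of `u_j` at
`x` is at most a constant times `1 + f(x,Du) + |f(x,Du_j) - f(x,Du)|`, and the last term tends to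
`0` in `L¹`. Along a subsequence converging a.e., generalized dominated convergence therefore yields
the averaged deviation of `u` itself, which is below `ε |B_ρ|` once `ρ` is small. So some `j` and a
set of centres of positive measure work (`exists_center_lintegral_lt`). Since `q < N`, the function
`|y - a|^{-q}` is integrable in `a`, and almost every centre gives a map in `W^{1,q}`
(`ae_hasWeakGrad_radialProj`).

The delicate point is the smallness for `u`: as `a → 0` the deviation tends to `0` pointwise, but
domination needs `f(x, D((u-a)/|u-a|)) ≤ c (1 + f(x,Du))` uniformly in small `a`, and the growth
(H2) with `p < q` does not give this. It follows from (H5) and convexity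
(`exists_pointwise_bound_of_average`). First (H5), tested on affine maps, becomes a statement about
all values `b` and matrices `ζ` at almost every `x` (`AveragedProjectionBound.pointwise`). Write `η`
for the projected gradient and `Q` for the gradient of `f(x,·)` at `η`. A whole ball of centres `a'`
near a suitable vector of length `1/4` satisfies `⟨Q, Dπ(-a')ζ⟩ ≥ ⟨Q, η⟩`, where `π(y) = y/|y|`, so
convexity makes `f(x,η)` a lower bound for the averaged integrand on that ball. -/

open scoped Convolution

/-! ### Convergence of integrals and of mollifications -/

/-- Generalized dominated convergence, as an upper bound for the limit. -/
theorem eventually_lintegral_lt_of_dominated {α : Type*} [MeasurableSpace α] {ν : Measure α}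
    {F E : ℕ → α → ℝ≥0∞} {F' G : α → ℝ≥0∞} (hF : ∀ j, AEMeasurable (F j) ν)
    (hG : AEMeasurable G ν) (hGi : ∫⁻ x, G x ∂ν ≠ ⊤)
    (hE : Tendsto (fun j => ∫⁻ x, E j x ∂ν) atTop (𝓝 0))
    (hb : ∀ j, ∀ᵐ x ∂ν, F j x ≤ G x + E j x) (hF'G : ∀ᵐ x ∂ν, F' x ≤ G x)
    (hlim : ∀ᵐ x ∂ν, Tendsto (fun j => F j x) atTop (𝓝 (F' x))) {c : ℝ≥0∞}
    (hc : ∫⁻ x, F' x ∂ν < c) : ∀ᶠ j in atTop, ∫⁻ x, F j x ∂ν < c := by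
  -- Truncation at `G` gives a dominated sequence with the same limit, because `F' ≤ G`; the part
  -- cut off is at most `E j`.
  have h1 : Tendsto (fun j => ∫⁻ x, min (F j x) (G x) ∂ν) atTop (𝓝 (∫⁻ x, F' x ∂ν)) := by
    refine tendsto_lintegral_of_dominated_convergence' G (fun j => (hF j).min hG)
      (fun j => Eventually.of_forall fun x => min_le_right _ _) hGi ?_
    filter_upwards [hlim, hF'G] with x hx hx'
    simpa [min_eq_left hx'] using hx.min (tendsto_const_nhds (x := G x))
  have h2 := h1.add hE
  rw [add_zero] at h2
  filter_upwards [h2.eventually_lt_const hc] with j hj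
  refine lt_of_le_of_lt ?_ hj
  rw [← lintegral_add_left' ((hF j).min hG)]
  refine lintegral_mono_ae ?_
  filter_upwards [hb j] with x hx
  rcases le_total (F j x) (G x) with h | h
  · simp [min_eq_left h]
  · simpa [min_eq_right h] using hx

theorem tendsto_lintegral_zero_of_dominated {α : Type*} [MeasurableSpace α] {ν : Measure α}
    {F E : ℕ → α → ℝ≥0∞} {G : α → ℝ≥0∞} (hF : ∀ j, AEMeasurable (F j) ν)
    (hG : AEMeasurable G ν) (hGi : ∫⁻ x, G x ∂ν ≠ ⊤)
    (hE : Tendsto (fun j => ∫⁻ x, E j x ∂ν) atTop (𝓝 0))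
    (hb : ∀ j, ∀ᵐ x ∂ν, F j x ≤ G x + E j x)
    (hlim : ∀ᵐ x ∂ν, Tendsto (fun j => F j x) atTop (𝓝 0)) :
    Tendsto (fun j => ∫⁻ x, F j x ∂ν) atTop (𝓝 0) := by
  refine tendsto_order.2 ⟨fun a ha => absurd ha not_lt_zero, fun c hc => ?_⟩
  exact eventually_lintegral_lt_of_dominated hF hG hGi hE hb (F' := fun _ => 0)
    (Eventually.of_forall fun x => zero_le) hlim (by simpa using hc)

/-- Scheffé's lemma for a sequence with constant integral. -/
theorem tendsto_lintegral_sub_of_integral_eq {α : Type*} [MeasurableSpace α] {ν : Measure α}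
    {m : ℕ → α → ℝ} {g : α → ℝ} (hm : ∀ j, Integrable (m j) ν) (hg : Integrable g ν)
    (hm0 : ∀ j x, 0 ≤ m j x) (hg0 : ∀ x, 0 ≤ g x)
    (heq : ∀ j, ∫ x, m j x ∂ν = ∫ x, g x ∂ν)
    (hlim : ∀ᵐ x ∂ν, Tendsto (fun j => m j x) atTop (𝓝 (g x))) :
    Tendsto (fun j => ∫⁻ x, ‖m j x - g x‖ₑ ∂ν) atTop (𝓝 0) := by
  have h1 : ∀ j, ∫⁻ x, ‖m j x - g x‖ₑ ∂ν
      = ENNReal.ofReal (2 * ∫ x, max (g x - m j x) 0 ∂ν) := by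
    intro j
    have hi := (hg.sub (hm j)).pos_part
    have h0 := ofReal_integral_norm_eq_lintegral_enorm ((hm j).sub hg)
    simp only [Pi.sub_apply] at h0
    rw [← h0]
    congr 1
    -- `|t| = t + 2 max(-t, 0)` with `t = m j - g`, whose integral vanishes. The remaining positive
    -- part of `g - m j` is dominated by `g`, since `m j ≥ 0`.
    have : ∀ x, ‖m j x - g x‖ = (m j x - g x) + 2 * max (g x - m j x) 0 := by
      intro x
      rw [Real.norm_eq_abs]
      rcases le_total (g x) (m j x) with h | h
      · rw [max_eq_right (by linarith), abs_of_nonneg (by linarith)]; ring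
      · rw [max_eq_left (by linarith), abs_of_nonpos (by linarith)]; ring
    simp only [this]
    have hi' : Integrable (fun x => 2 * max (g x - m j x) 0) ν := hi.const_mul 2
    have hi2 : Integrable (fun x => m j x - g x) ν := (hm j).sub hg
    rw [integral_add hi2 hi', integral_sub (hm j) hg, heq,
      sub_self, zero_add, integral_const_mul]
  simp only [h1]
  have h2 : Tendsto (fun j => ∫ x, max (g x - m j x) 0 ∂ν) atTop (𝓝 (∫ x, (0 : ℝ) ∂ν)) := by
    refine tendsto_integral_of_dominated_convergence g
      (fun j => ((hg.sub (hm j)).pos_part).aestronglyMeasurable) hg ?_ ?_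
    · intro j
      refine Eventually.of_forall fun x => ?_
      rw [Real.norm_of_nonneg (le_max_right _ _)]
      exact max_le (by linarith [hm0 j x]) (hg0 x)
    · filter_upwards [hlim] with x hx
      have := ((tendsto_const_nhds (x := g x)).sub hx).max (tendsto_const_nhds (x := (0 : ℝ)))
      simpa using this
  have h3 := (ENNReal.continuous_ofReal.tendsto _).comp (h2.const_mul 2)
  simp only [integral_zero, mul_zero, ENNReal.ofReal_zero] at h3
  exact h3

/-- Mollifications of an integrable function converge in `L¹`. -/
theorem tendsto_lintegral_enorm_mollify_sub {G E : Type*} [NormedAddCommGroup G] [NormedSpace ℝ G]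
    [FiniteDimensional ℝ G] [MeasurableSpace G] [BorelSpace G] {ν : Measure G}
    [ν.IsAddHaarMeasure] [NormedAddCommGroup E] [NormedSpace ℝ E] [CompleteSpace E]
    {φ : ℕ → ContDiffBump (0 : G)} {K : ℝ} (hφ : Tendsto (fun j => (φ j).rOut) atTop (𝓝 0))
    (hφ' : ∀ j, (φ j).rOut ≤ K * (φ j).rIn) {V : G → E} (hV : Integrable V ν) :
    Tendsto (fun j => ∫⁻ x, ‖((φ j).normed ν ⋆[ContinuousLinearMap.lsmul ℝ ℝ, ν] V) x - V x‖ₑ ∂ν)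
      atTop (𝓝 0) := by
  have hi : ∀ j, Integrable ((φ j).normed ν) ν := fun j => (φ j).integrable_normed
  have hVj : ∀ j, Integrable ((φ j).normed ν ⋆[ContinuousLinearMap.lsmul ℝ ℝ, ν] V) ν :=
    fun j => (hi j).integrable_convolution _ hV
  -- The mollified norm dominates the norm of the mollification and keeps the integral of `‖V‖`, so
  -- Scheffé's lemma makes `m j - ‖V‖` an admissible vanishing error.
  set m : ℕ → G → ℝ := fun j =>
    (φ j).normed ν ⋆[ContinuousLinearMap.lsmul ℝ ℝ, ν] (fun x => ‖V x‖) with hmdef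
  have hm : ∀ j, Integrable (m j) ν := fun j => (hi j).integrable_convolution _ hV.norm
  have hle : ∀ j x, ‖((φ j).normed ν ⋆[ContinuousLinearMap.lsmul ℝ ℝ, ν] V) x‖ ≤ m j x := by
    intro j x
    refine (norm_integral_le_integral_norm _).trans_eq ?_
    refine integral_congr_ae (Eventually.of_forall fun t => ?_)
    simp [norm_smul, abs_of_nonneg ((φ j).nonneg_normed t)]
  have hmeq : ∀ j, ∫ x, m j x ∂ν = ∫ x, ‖V x‖ ∂ν := by
    intro j
    rw [hmdef]
    simp only
    rw [integral_convolution _ (hi j) hV.norm, (φ j).integral_normed]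
    simp
  have hae := ContDiffBump.ae_convolution_tendsto_right_of_locallyIntegrable hφ
    (Eventually.of_forall hφ') hV.locallyIntegrable
  have hae' := ContDiffBump.ae_convolution_tendsto_right_of_locallyIntegrable hφ
    (Eventually.of_forall hφ') hV.norm.locallyIntegrable
  have hE := tendsto_lintegral_sub_of_integral_eq hm hV.norm
    (fun j x => (norm_nonneg _).trans (hle j x)) (fun x => norm_nonneg _) hmeq hae'
  refine tendsto_lintegral_zero_of_dominated (G := fun x => 2 * ‖V x‖ₑ)
    (fun j => ((hVj j).sub hV).aestronglyMeasurable.enorm) (hV.aestronglyMeasurable.enorm.const_mul 2)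
    ?_ hE ?_ ?_
  · rw [lintegral_const_mul'' _ hV.aestronglyMeasurable.enorm]
    exact ENNReal.mul_ne_top (by simp) hV.hasFiniteIntegral.ne
  · intro j
    refine Eventually.of_forall fun x => ?_
    have h1 : ‖((φ j).normed ν ⋆[ContinuousLinearMap.lsmul ℝ ℝ, ν] V) x - V x‖
        ≤ 2 * ‖V x‖ + ‖m j x - ‖V x‖‖ := by
      have := norm_sub_le (((φ j).normed ν ⋆[ContinuousLinearMap.lsmul ℝ ℝ, ν] V) x) (V x)
      have := hle j x
      have := le_abs_self (m j x - ‖V x‖)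
      rw [Real.norm_eq_abs]
      linarith
    rw [← ofReal_norm, ← ofReal_norm, ← ofReal_norm (m j x - ‖V x‖), ← ENNReal.ofReal_ofNat 2,
      ← ENNReal.ofReal_mul (by norm_num), ← ENNReal.ofReal_add (by positivity) (by positivity)]
    exact ENNReal.ofReal_le_ofReal h1
  · filter_upwards [hae] with x hx
    have := (hx.sub (tendsto_const_nhds (x := V x))).enorm
    simpa using this

/-! ### Matrices by columns and the chain rule for weak gradients -/

/-- The `k`-th column of a matrix. -/
noncomputable def matCol {n N : ℕ} (ζ : EucMat N n) (k : Fin n) : Euc N :=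
  WithLp.toLp 2 fun i => ζ (i, k)

@[simp] theorem matCol_apply {n N : ℕ} (ζ : EucMat N n) (k : Fin n) (i : Fin N) :
    matCol ζ k i = ζ (i, k) := rfl

theorem norm_sq_eq_sum_matCol {n N : ℕ} (ζ : EucMat N n) :
    ‖ζ‖ ^ 2 = ∑ k, ‖matCol ζ k‖ ^ 2 := by
  simp only [EuclideanSpace.norm_sq_eq, matCol_apply]
  rw [Fintype.sum_prod_type, Finset.sum_comm]

theorem inner_eq_sum_matCol {n N : ℕ} (ζ ξ : EucMat N n) :
    inner ℝ ζ ξ = ∑ k, inner ℝ (matCol ζ k) (matCol ξ k) := by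
  simp only [PiLp.inner_apply, matCol_apply]
  rw [Fintype.sum_prod_type, Finset.sum_comm]

/-- The product of a linear map of `ℝ^N` with a matrix. -/
noncomputable def matMap {n N : ℕ} (A : Euc N →L[ℝ] Euc N) (ζ : EucMat N n) : EucMat N n :=
  WithLp.toLp 2 fun z => A (matCol ζ z.2) z.1

@[simp] theorem matMap_apply {n N : ℕ} (A : Euc N →L[ℝ] Euc N) (ζ : EucMat N n)
    (z : Fin N × Fin n) : matMap A ζ z = A (matCol ζ z.2) z.1 := rfl

@[simp] theorem matCol_matMap {n N : ℕ} (A : Euc N →L[ℝ] Euc N) (ζ : EucMat N n) (k : Fin n) :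
    matCol (matMap A ζ) k = A (matCol ζ k) := rfl

theorem norm_matMap_le {n N : ℕ} (A : Euc N →L[ℝ] Euc N) (ζ : EucMat N n) :
    ‖matMap A ζ‖ ≤ ‖A‖ * ‖ζ‖ := by
  refine le_of_sq_le_sq ?_ (by positivity)
  rw [mul_pow, norm_sq_eq_sum_matCol, norm_sq_eq_sum_matCol ζ, Finset.mul_sum]
  refine Finset.sum_le_sum fun k _ => ?_
  rw [matCol_matMap, ← mul_pow]
  gcongr
  exact A.le_opNorm _

/-- `matMap` as a continuous bilinear map. -/
noncomputable def matMapL (n N : ℕ) :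
    (Euc N →L[ℝ] Euc N) →L[ℝ] EucMat N n →L[ℝ] EucMat N n :=
  LinearMap.mkContinuous₂
    (LinearMap.mk₂ ℝ matMap
      (fun A B ζ => by ext z; simp) (fun c A ζ => by ext z; simp)
      (fun A ζ ξ => by
        ext z
        have : matCol (ζ + ξ) z.2 = matCol ζ z.2 + matCol ξ z.2 := rfl
        simp [this])
      (fun c A ζ => by
        ext z
        have : matCol (c • ζ) z.2 = c • matCol ζ z.2 := rfl
        simp [this]))
    1 (fun A ζ => by simpa using norm_matMap_le A ζ)

@[simp] theorem matMapL_apply {n N : ℕ} (A : Euc N →L[ℝ] Euc N) (ζ : EucMat N n) :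
    matMapL n N A ζ = matMap A ζ := rfl

theorem continuous_matMap {n N : ℕ} :
    Continuous fun z : (Euc N →L[ℝ] Euc N) × EucMat N n => matMap z.1 z.2 := by
  have := (matMapL n N).continuous₂
  exact this

theorem matMap_sub_right {n N : ℕ} (A : Euc N →L[ℝ] Euc N) (ζ ξ : EucMat N n) :
    matMap A (ζ - ξ) = matMap A ζ - matMap A ξ := (matMapL n N A).map_sub ζ ξ

theorem norm_apply_le_norm {ι : Type*} [Fintype ι] (y : EuclideanSpace ℝ ι) (i : ι) :
    |y i| ≤ ‖y‖ := by
  simpa using PiLp.norm_apply_le y i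

theorem setIntegral_eq_integral_of_tsupport_subset {E : Type*} [TopologicalSpace E]
    [MeasurableSpace E] {ν : Measure E} {U : Set E} {F φ : E → ℝ}
    (hφ : tsupport φ ⊆ U) (hF : ∀ x, x ∉ tsupport φ → F x = 0) :
    ∫ x in U, F x ∂ν = ∫ x, F x ∂ν :=
  setIntegral_eq_integral_of_forall_compl_eq_zero fun x hx => hF x fun h => hx (hφ h)

theorem fderiv_eq_zero_of_notMem_tsupport {E F : Type*} [NormedAddCommGroup E] [NormedSpace ℝ E]
    [NormedAddCommGroup F] [NormedSpace ℝ F]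
    {φ : E → F} {x : E} (hx : x ∉ tsupport φ) : fderiv ℝ φ x = 0 :=
  image_eq_zero_of_notMem_tsupport fun h => hx (tsupport_fderiv_subset ℝ h)

theorem LocallyIntegrableOn.mono_restrict {X E F : Type*} [TopologicalSpace X] [MeasurableSpace X]
    [OpensMeasurableSpace X] [NormedAddCommGroup E] [NormedAddCommGroup F] {ν : Measure X}
    {U : Set X} {f : X → E} {g : X → F} (hf : LocallyIntegrableOn f U ν)
    (hg : AEStronglyMeasurable g (ν.restrict U)) (h : ∀ᵐ x ∂ν.restrict U, ‖g x‖ ≤ ‖f x‖) :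
    LocallyIntegrableOn g U ν := by
  intro x hx
  obtain ⟨s, hs, hfs⟩ := hf x hx
  refine ⟨s ∩ U, Filter.inter_mem hs self_mem_nhdsWithin, ?_⟩
  have h1 : ν.restrict (s ∩ U) ≤ ν.restrict U := Measure.restrict_mono Set.inter_subset_right le_rfl
  exact Integrable.mono (hfs.mono_set Set.inter_subset_left) (hg.mono_measure h1)
    (ae_mono h1 h)

theorem locallyIntegrableOn_comp_of_bound {n N : ℕ} {U : Set (Euc n)} {v : Euc n → Euc N}
    (hv : LocallyIntegrableOn v U volume) {Ψ : Euc N → Euc N} (hΨ : Continuous Ψ) {c L : ℝ}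
    (hb : ∀ y, ‖Ψ y‖ ≤ c + L * ‖y‖) :
    LocallyIntegrableOn (fun x => Ψ (v x)) U volume := by
  have h1 : LocallyIntegrableOn (fun x => c + L * ‖v x‖) U volume := by
    refine LocallyIntegrableOn.add ((locallyIntegrable_const c).locallyIntegrableOn U) ?_
    exact hv.norm.smul L
  refine LocallyIntegrableOn.mono_restrict h1
    (hΨ.comp_aestronglyMeasurable hv.aestronglyMeasurable) ?_
  exact Eventually.of_forall fun x => (hb _).trans (le_abs_self _)

theorem fderiv_convolution_lsmul_apply {n : ℕ} {E : Type*} [NormedAddCommGroup E]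
    [NormedSpace ℝ E] [CompleteSpace E] {ρ : Euc n → ℝ} (hρ : ContDiff ℝ ∞ ρ)
    (hρc : HasCompactSupport ρ) {V : Euc n → E} (hV : Integrable V volume) (x e : Euc n) :
    fderiv ℝ (ρ ⋆[ContinuousLinearMap.lsmul ℝ ℝ, volume] V) x e
      = ∫ y, fderiv ℝ ρ (x - y) e • V y := by
  have h1 : ContDiff ℝ 1 ρ := hρ.of_le (by simp)
  have hd := hρc.hasFDerivAt_convolution_right (ContinuousLinearMap.lsmul ℝ ℝ).flip
    hV.locallyIntegrable h1 x
  rw [convolution_flip] at hd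
  rw [hd.fderiv, convolution_precompR_apply _ hV.locallyIntegrable (hρc.fderiv ℝ)
    (h1.continuous_fderiv one_ne_zero)]
  rfl

theorem integral_smul_apply_coord {n : ℕ} {ι : Type*} [Fintype ι] {g : Euc n → ℝ}
    (hg : Continuous g) (hgc : HasCompactSupport g) {V : Euc n → EuclideanSpace ℝ ι}
    (hV : Integrable V volume) (x : Euc n) (i : ι) :
    (∫ y, g (x - y) • V y) i = ∫ y, g (x - y) * V y i := by
  have hint : Integrable (fun y => g (x - y) • V y) volume :=
    (hgc.convolutionExists_left (ContinuousLinearMap.lsmul ℝ ℝ) hg hV.locallyIntegrable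
      x).integrable_swap
  have e1 := (EuclideanSpace.proj i : EuclideanSpace ℝ ι →L[ℝ] ℝ).integral_comp_comm hint
  simpa using e1.symm

/-- On the interior of the domain, the derivative of a mollification is the mollification of the
weak derivative. -/
theorem fderiv_mollify_apply {n N : ℕ} {U K' : Set (Euc n)} {v : Euc n → Euc N}
    {Dv : Euc n → EucMat N n} (h : HasWeakGrad U v Dv) (hK' : IsCompact K')
    (hK'U : K' ⊆ U) {ρ : Euc n → ℝ} (hρ : ContDiff ℝ ∞ ρ)
    (hρc : HasCompactSupport ρ) {r : ℝ} (hρr : Function.support ρ ⊆ Metric.ball 0 r) {x : Euc n}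
    (hx : Metric.closedBall x r ⊆ K') (k : Fin n) (i : Fin N) :
    fderiv ℝ (ρ ⋆[ContinuousLinearMap.lsmul ℝ ℝ, volume] (K'.indicator v)) x
        (EuclideanSpace.single k 1) i
      = (ρ ⋆[ContinuousLinearMap.lsmul ℝ ℝ, volume] (K'.indicator Dv)) x (i, k) := by
  have hvi : Integrable (K'.indicator v) volume :=
    (h.1.integrableOn_compact_subset hK'U hK').integrable_indicator hK'.measurableSet
  have hDvi : Integrable (K'.indicator Dv) volume :=
    (h.2.1.integrableOn_compact_subset hK'U hK').integrable_indicator hK'.measurableSet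
  -- The reflected kernel is itself an admissible test function; the sign produced by the reflection
  -- cancels the one in the definition of the weak gradient.
  set Φ : Euc n → ℝ := fun y => ρ (x - y) with hΦ
  have hΦs : ContDiff ℝ ∞ Φ := hρ.comp (contDiff_const.sub contDiff_id)
  have hsupp : tsupport Φ ⊆ Metric.closedBall x r := by
    refine closure_minimal ?_ Metric.isClosed_closedBall
    intro y hy
    have : x - y ∈ Function.support ρ := hy
    rw [Metric.mem_closedBall, dist_comm, dist_eq_norm]
    simpa using (Metric.mem_ball.1 (hρr this)).le
  have hΦc : HasCompactSupport Φ :=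
    IsCompact.of_isClosed_subset (isCompact_closedBall x r) (isClosed_tsupport _) hsupp
  have hΦd : ∀ y, fderiv ℝ Φ y = - fderiv ℝ ρ (x - y) := by
    intro y
    have h1 : HasFDerivAt (fun y : Euc n => x - y) (-ContinuousLinearMap.id ℝ (Euc n)) y :=
      (hasFDerivAt_id y).const_sub x
    have h2 := ((hρ.differentiable (by simp)) (x - y)).hasFDerivAt.comp y h1
    refine h2.fderiv.trans ?_
    ext; simp
  have hw := h.2.2 Φ hΦs hΦc (hsupp.trans (hx.trans hK'U)) i k
  rw [setIntegral_eq_integral_of_tsupport_subset (φ := Φ) (hsupp.trans (hx.trans hK'U))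
    (fun y hy => by simp [fderiv_eq_zero_of_notMem_tsupport hy]),
    setIntegral_eq_integral_of_tsupport_subset (φ := Φ) (hsupp.trans (hx.trans hK'U))
    (fun y hy => by simp [image_eq_zero_of_notMem_tsupport hy])] at hw
  have hcont : Continuous (fun z => fderiv ℝ ρ z (EuclideanSpace.single k 1)) :=
    (hρ.continuous_fderiv (by simp)).clm_apply continuous_const
  have hcomp : HasCompactSupport (fun z => fderiv ℝ ρ z (EuclideanSpace.single k 1)) :=
    hρc.fderiv_apply ℝ _
  rw [fderiv_convolution_lsmul_apply hρ hρc hvi, convolution_eq_swap,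
    integral_smul_apply_coord hcont hcomp hvi]
  refine Eq.trans ?_ (integral_smul_apply_coord hρ.continuous hρc hDvi x (i, k)).symm
  have hz : ∀ y, y ∉ K' → y ∉ tsupport Φ := fun y hy hy' => hy (hx (hsupp hy'))
  have l1 : ∫ y, fderiv ℝ Φ y (EuclideanSpace.single k 1) * v y i
      = - ∫ y, fderiv ℝ ρ (x - y) (EuclideanSpace.single k 1) * K'.indicator v y i := by
    rw [← integral_neg]
    refine integral_congr_ae (Eventually.of_forall fun y => ?_)
    by_cases hy : y ∈ K'
    · simp [hΦd, Set.indicator_of_mem hy]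
    · simp [fderiv_eq_zero_of_notMem_tsupport (hz y hy), Set.indicator_of_notMem hy]
  have l2 : ∫ y, Φ y * Dv y (i, k) = ∫ y, ρ (x - y) * K'.indicator Dv y (i, k) := by
    refine integral_congr_ae (Eventually.of_forall fun y => ?_)
    by_cases hy : y ∈ K'
    · simp [hΦ, Set.indicator_of_mem hy]
    · simp [image_eq_zero_of_notMem_tsupport (hz y hy), Set.indicator_of_notMem hy]
  rw [l1, l2] at hw
  linarith

theorem lintegral_enorm_mul_sub_tendsto_zero {α : Type*} [MeasurableSpace α] {ν : Measure α}
    {E : Type*} [NormedAddCommGroup E] {X : ℕ → α → E} {X' : α → E} {ψ : α → ℝ} {c : ℝ}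
    (hψ : ∀ x, |ψ x| ≤ c) (l : E → ℝ) (hl : ∀ a b, |l a - l b| ≤ ‖a - b‖)
    (h : Tendsto (fun j => ∫⁻ x, ‖X j x - X' x‖ₑ ∂ν) atTop (𝓝 0)) :
    Tendsto (fun j => ∫⁻ x, ‖ψ x * l (X j x) - ψ x * l (X' x)‖ₑ ∂ν) atTop (𝓝 0) := by
  have h1 := ENNReal.Tendsto.const_mul (a := ENNReal.ofReal c) h (Or.inr ENNReal.ofReal_ne_top)
  rw [mul_zero] at h1
  refine tendsto_of_tendsto_of_tendsto_of_le_of_le tendsto_const_nhds h1 (fun _ => zero_le) ?_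
  intro j
  simp only
  rw [← lintegral_const_mul' _ _ ENNReal.ofReal_ne_top]
  refine lintegral_mono fun x => ?_
  rw [← mul_sub, ← ofReal_norm, ← ofReal_norm, ← ENNReal.ofReal_mul ((abs_nonneg _).trans (hψ x))]
  refine ENNReal.ofReal_le_ofReal ?_
  rw [norm_mul]
  exact mul_le_mul (hψ x) (hl _ _) (abs_nonneg _) ((abs_nonneg _).trans (hψ x))

/-- The comparability of the two radii is what almost everywhere convergence of mollifications
requires; the bound by `δ` keeps the mollifications inside the domain. -/
theorem exists_contDiffBump_seq {G : Type*} [NormedAddCommGroup G] [NormedSpace ℝ G] {δ : ℝ}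
    (hδ : 0 < δ) : ∃ b : ℕ → ContDiffBump (0 : G),
      Tendsto (fun j => (b j).rOut) atTop (𝓝 0) ∧ (∀ j, (b j).rOut ≤ 2 * (b j).rIn) ∧
      ∀ j, (b j).rOut ≤ δ := by
  have hp : ∀ j : ℕ, 0 < δ / (j + 1) := fun j => by positivity
  refine ⟨fun j => ⟨δ / (j + 1) / 2, δ / (j + 1), half_pos (hp j), half_lt_self (hp j)⟩,
    ?_, fun j => ?_, fun j => ?_⟩
  · simpa [div_eq_mul_inv] using tendsto_one_div_add_atTop_nhds_zero_nat.const_mul δ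
  · simp only; linarith
  · exact div_le_self hδ.le (by linarith [j.cast_nonneg (α := ℝ)])

theorem norm_sub_le_of_fderiv_le {E F : Type*} [NormedAddCommGroup E] [NormedSpace ℝ E]
    [NormedAddCommGroup F] [NormedSpace ℝ F] {Ψ : E → F} (hΨ : ContDiff ℝ 1 Ψ) {L : ℝ}
    (hL : ∀ y, ‖fderiv ℝ Ψ y‖ ≤ L) (a b : E) : ‖Ψ a - Ψ b‖ ≤ L * ‖a - b‖ :=
  Convex.norm_image_sub_le_of_norm_fderiv_le (𝕜 := ℝ)
    (fun x _ => (hΨ.differentiable one_ne_zero) x) (fun x _ => hL x) convex_univ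
    (Set.mem_univ _) (Set.mem_univ _)

/-- The chain rule for smooth maps. The gradient identity is asked for on the support of `φ` only,
since a mollified truncation has the mollified weak gradient only away from the edge of the
truncation. -/
theorem integral_mul_fderiv_comp_eq {n N : ℕ} {φ : Euc n → ℝ} (hφ : ContDiff ℝ ∞ φ)
    (hφc : HasCompactSupport φ) {Ψ : Euc N → Euc N} (hΨ : ContDiff ℝ 1 Ψ)
    {V : Euc n → Euc N} (hV : ContDiff ℝ 1 V) {W : Euc n → EucMat N n}
    (hW : ∀ x ∈ tsupport φ, ∀ k i, fderiv ℝ V x (EuclideanSpace.single k 1) i = W x (i, k))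
    (i : Fin N) (k : Fin n) :
    ∫ x, fderiv ℝ φ x (EuclideanSpace.single k 1) * Ψ (V x) i
      = - ∫ x, φ x * matMap (fderiv ℝ Ψ (V x)) (W x) (i, k) := by
  have hg : ContDiff ℝ 1 (fun x => Ψ (V x) i) :=
    (EuclideanSpace.proj i : Euc N →L[ℝ] ℝ).contDiff.comp (hΨ.comp hV)
  have hφ1 : ContDiff ℝ 1 φ := hφ.of_le (by simp)
  have hc1 : Continuous fun x => fderiv ℝ φ x (EuclideanSpace.single k 1) :=
    (hφ1.continuous_fderiv one_ne_zero).clm_apply continuous_const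
  have hc2 : Continuous fun x =>
      fderiv ℝ (fun x => Ψ (V x) i) x (EuclideanSpace.single k (1 : ℝ)) :=
    (hg.continuous_fderiv one_ne_zero).clm_apply continuous_const
  have key := integral_mul_fderiv_eq_neg_fderiv_mul_of_integrable
    (μ := (volume : Measure (Euc n))) (f := φ) (g := fun x => Ψ (V x) i)
    (v := EuclideanSpace.single k (1 : ℝ))
    ((hc1.mul hg.continuous).integrable_of_hasCompactSupport
      ((hφc.fderiv_apply ℝ _).mul_right))
    ((hφ.continuous.mul hc2).integrable_of_hasCompactSupport hφc.mul_right)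
    ((hφ.continuous.mul hg.continuous).integrable_of_hasCompactSupport hφc.mul_right)
    (fun x _ => hφ1.differentiable one_ne_zero x) (fun x _ => hg.differentiable one_ne_zero x)
  rw [← neg_eq_iff_eq_neg] at key
  rw [← key]
  congr 1
  refine integral_congr_ae (Eventually.of_forall fun x => ?_)
  by_cases hx : x ∈ tsupport φ
  · have h1 : HasFDerivAt (fun x => Ψ (V x) i) ((EuclideanSpace.proj i : Euc N →L[ℝ] ℝ).comp
        ((fderiv ℝ Ψ (V x)).comp (fderiv ℝ V x))) x :=
      (EuclideanSpace.proj i : Euc N →L[ℝ] ℝ).hasFDerivAt.comp x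
        (((hΨ.differentiable one_ne_zero) (V x)).hasFDerivAt.comp x
          ((hV.differentiable one_ne_zero) x).hasFDerivAt)
    have h2 : fderiv ℝ V x (EuclideanSpace.single k 1) = matCol (W x) k := by
      ext l
      rw [hW x hx, matCol_apply]
    simp only [h1.fderiv, ContinuousLinearMap.comp_apply, h2, matMap_apply]
    rfl
  · simp [image_eq_zero_of_notMem_tsupport hx]

/-- The chain rule for weak gradients and `C¹` maps with bounded derivative. -/
theorem HasWeakGrad.comp_of_fderiv_le {n N : ℕ} {U : Set (Euc n)} {v : Euc n → Euc N}
    {Dv : Euc n → EucMat N n} (h : HasWeakGrad U v Dv) (hU : IsOpen U)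
    {Ψ : Euc N → Euc N} (hΨ : ContDiff ℝ 1 Ψ) {L : ℝ} (hL : ∀ y, ‖fderiv ℝ Ψ y‖ ≤ L) :
    HasWeakGrad U (fun x => Ψ (v x)) (fun x => matMap (fderiv ℝ Ψ (v x)) (Dv x)) := by
  have hL0 : 0 ≤ L := (norm_nonneg _).trans (hL 0)
  have hA : Continuous (fderiv ℝ Ψ) := hΨ.continuous_fderiv one_ne_zero
  have hlip := norm_sub_le_of_fderiv_le hΨ hL
  refine ⟨?_, ?_, ?_⟩
  · refine locallyIntegrableOn_comp_of_bound h.1 hΨ.continuous (c := ‖Ψ 0‖) (L := L) fun y => ?_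
    have h1 := hlip y 0
    have h2 := norm_add_le (Ψ y - Ψ 0) (Ψ 0)
    rw [sub_add_cancel] at h2
    rw [sub_zero] at h1
    linarith
  · refine LocallyIntegrableOn.mono_restrict (h.2.1.norm.smul L)
      (continuous_matMap.comp_aestronglyMeasurable
        ((hA.comp_aestronglyMeasurable h.1.aestronglyMeasurable).prodMk
          h.2.1.aestronglyMeasurable)) (Eventually.of_forall fun x => ?_)
    refine (norm_matMap_le _ _).trans ?_
    simp only [Pi.smul_apply, smul_eq_mul, norm_mul, norm_norm]
    gcongr
    exact (hL _).trans (le_abs_self _)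
  intro φ hφ hφc hφU i k
  -- Truncating to a compact neighbourhood `K'` of the support of `φ` makes `v` and `Dv` integrable
  -- on the whole space; mollifying at scale at most `δ` does not see the truncation on that
  -- support.
  obtain ⟨K', hK', hKK', hK'U⟩ := exists_compact_between hφc hU hφU
  obtain ⟨δ, hδ, hδK⟩ := hφc.isCompact.exists_cthickening_subset_open isOpen_interior hKK'
  obtain ⟨b, hb0, hb2, hbδ⟩ := exists_contDiffBump_seq (G := Euc n) hδ
  set V := K'.indicator v with hV
  set W := K'.indicator Dv with hW
  have hVi : Integrable V volume :=
    (h.1.integrableOn_compact_subset hK'U hK').integrable_indicator hK'.measurableSet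
  have hWi : Integrable W volume :=
    (h.2.1.integrableOn_compact_subset hK'U hK').integrable_indicator hK'.measurableSet
  set Vj : ℕ → Euc n → Euc N := fun j =>
    (b j).normed volume ⋆[ContinuousLinearMap.lsmul ℝ ℝ, volume] V with hVj
  set Wj : ℕ → Euc n → EucMat N n := fun j =>
    (b j).normed volume ⋆[ContinuousLinearMap.lsmul ℝ ℝ, volume] W with hWj
  have hVjs : ∀ j, ContDiff ℝ 1 (Vj j) := fun j =>
    (b j).hasCompactSupport_normed.contDiff_convolution_left _ (b j).contDiff_normed
      hVi.locallyIntegrable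
  have hWjs : ∀ j, ContDiff ℝ 1 (Wj j) := fun j =>
    (b j).hasCompactSupport_normed.contDiff_convolution_left _ (b j).contDiff_normed
      hWi.locallyIntegrable
  have hsub : ∀ x ∈ tsupport φ, ∀ j, Metric.closedBall x (b j).rOut ⊆ K' := fun x hx j =>
    (Metric.closedBall_subset_closedBall (hbδ j)).trans
      ((Metric.closedBall_subset_cthickening hx δ).trans (hδK.trans interior_subset))
  have hgrad : ∀ j, ∀ x ∈ tsupport φ, ∀ k i,
      fderiv ℝ (Vj j) x (EuclideanSpace.single k 1) i = Wj j x (i, k) := fun j x hx k i =>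
    fderiv_mollify_apply h hK' hK'U (b j).contDiff_normed (b j).hasCompactSupport_normed
      ((b j).support_normed_eq).subset (hsub x hx j) k i
  have hparts : ∀ j, ∫ x, fderiv ℝ φ x (EuclideanSpace.single k 1) * Ψ (Vj j x) i
      = - ∫ x, φ x * matMap (fderiv ℝ Ψ (Vj j x)) (Wj j x) (i, k) := fun j =>
    integral_mul_fderiv_comp_eq hφ hφc hΨ (hVjs j) (hgrad j) i k
  have hVL := tendsto_lintegral_enorm_mollify_sub hb0 hb2 hVi
  have hWL := tendsto_lintegral_enorm_mollify_sub hb0 hb2 hWi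
  have hVae := ContDiffBump.ae_convolution_tendsto_right_of_locallyIntegrable hb0
    (Eventually.of_forall hb2) hVi.locallyIntegrable
  have hWae := ContDiffBump.ae_convolution_tendsto_right_of_locallyIntegrable hb0
    (Eventually.of_forall hb2) hWi.locallyIntegrable
  have hΨL : Tendsto (fun j => ∫⁻ x, ‖Ψ (Vj j x) - Ψ (V x)‖ₑ) atTop (𝓝 0) := by
    have h1 := ENNReal.Tendsto.const_mul (a := ENNReal.ofReal L) hVL
      (Or.inr ENNReal.ofReal_ne_top)
    rw [mul_zero] at h1
    refine tendsto_of_tendsto_of_tendsto_of_le_of_le tendsto_const_nhds h1 (fun _ => zero_le) ?_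
    intro j
    simp only
    rw [← lintegral_const_mul' _ _ ENNReal.ofReal_ne_top]
    refine lintegral_mono fun x => ?_
    rw [← ofReal_norm, ← ofReal_norm, ← ENNReal.ofReal_mul hL0]
    exact ENNReal.ofReal_le_ofReal (hlip _ _)
  have hmm : ∀ {V : Euc n → Euc N} {W : Euc n → EucMat N n}, AEStronglyMeasurable V volume →
      AEStronglyMeasurable W volume →
      AEStronglyMeasurable (fun x => matMap (fderiv ℝ Ψ (V x)) (W x)) volume := fun hV hW =>
    continuous_matMap.comp_aestronglyMeasurable ((hA.comp_aestronglyMeasurable hV).prodMk hW)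
  have hVm := fun j => (hVjs j).continuous.aestronglyMeasurable (μ := volume)
  have hWm := fun j => (hWjs j).continuous.aestronglyMeasurable (μ := volume)
  have hAL : Tendsto (fun j => ∫⁻ x, ‖matMap (fderiv ℝ Ψ (Vj j x)) (Wj j x)
      - matMap (fderiv ℝ Ψ (V x)) (W x)‖ₑ) atTop (𝓝 0) := by
    have hE := ENNReal.Tendsto.const_mul (a := ENNReal.ofReal L) hWL
      (Or.inr ENNReal.ofReal_ne_top)
    rw [mul_zero] at hE
    simp only [← lintegral_const_mul' _ _ (ENNReal.ofReal_ne_top (r := L))] at hE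
    refine tendsto_lintegral_zero_of_dominated
      (G := fun x => ENNReal.ofReal (2 * L) * ‖W x‖ₑ)
      (fun j => ((hmm (hVm j) (hWm j)).sub
        (hmm hVi.aestronglyMeasurable hWi.aestronglyMeasurable)).enorm)
      (hWi.aestronglyMeasurable.enorm.const_mul _) ?_ hE ?_ ?_
    · rw [lintegral_const_mul'' _ hWi.aestronglyMeasurable.enorm]
      exact ENNReal.mul_ne_top ENNReal.ofReal_ne_top hWi.hasFiniteIntegral.ne
    · intro j
      refine Eventually.of_forall fun x => ?_
      rw [← ofReal_norm, ← ofReal_norm, ← ofReal_norm, ← ENNReal.ofReal_mul (by positivity),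
        ← ENNReal.ofReal_mul hL0, ← ENNReal.ofReal_add (by positivity) (by positivity)]
      refine ENNReal.ofReal_le_ofReal ?_
      -- The splitting puts the error `Wj - W`, which vanishes in `L¹`, apart from terms dominated
      -- by `2 L ‖W‖`.
      have h1 : matMap (fderiv ℝ Ψ (Vj j x)) (Wj j x) - matMap (fderiv ℝ Ψ (V x)) (W x)
          = matMap (fderiv ℝ Ψ (Vj j x)) (Wj j x - W x)
            + matMap (fderiv ℝ Ψ (Vj j x)) (W x) - matMap (fderiv ℝ Ψ (V x)) (W x) := by
        rw [matMap_sub_right]; abel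
      rw [h1]
      have e1 := norm_sub_le (matMap (fderiv ℝ Ψ (Vj j x)) (Wj j x - W x)
            + matMap (fderiv ℝ Ψ (Vj j x)) (W x)) (matMap (fderiv ℝ Ψ (V x)) (W x))
      have e2 := norm_add_le (matMap (fderiv ℝ Ψ (Vj j x)) (Wj j x - W x))
        (matMap (fderiv ℝ Ψ (Vj j x)) (W x))
      have e3 : ∀ (y : Euc N) (ζ : EucMat N n), ‖matMap (fderiv ℝ Ψ y) ζ‖ ≤ L * ‖ζ‖ :=
        fun y ζ => (norm_matMap_le _ _).trans (by gcongr; exact hL y)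
      have := e3 (Vj j x) (Wj j x - W x)
      have := e3 (Vj j x) (W x)
      have := e3 (V x) (W x)
      simp only [hWj] at *
      linarith
    · filter_upwards [hVae, hWae] with x hx1 hx2
      have h1 := (continuous_matMap (n := n) (N := N)).continuousAt.tendsto.comp
        (((hA.tendsto (V x)).comp hx1).prodMk_nhds hx2)
      have h2 := (h1.sub (tendsto_const_nhds (x := matMap (fderiv ℝ Ψ (V x)) (W x)))).enorm
      simpa using h2
  obtain ⟨c, hc⟩ := hφc.exists_bound_of_continuous hφ.continuous
  have hc1 : Continuous fun x => fderiv ℝ φ x (EuclideanSpace.single k 1) :=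
    (hφ.continuous_fderiv (by simp)).clm_apply continuous_const
  obtain ⟨c', hc'⟩ := (hφc.fderiv_apply ℝ (EuclideanSpace.single k 1)).exists_bound_of_continuous
    hc1
  have T1 := lintegral_enorm_mul_sub_tendsto_zero hc' (fun y : Euc N => y i)
    (fun a b => norm_apply_le_norm (a - b) i) hΨL
  have T2 := lintegral_enorm_mul_sub_tendsto_zero hc (fun ζ : EucMat N n => ζ (i, k))
    (fun a b => norm_apply_le_norm (a - b) (i, k)) hAL
  have S1 := tendsto_integral_of_L1 _ ?_ (Eventually.of_forall fun j => ?_) T1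
  rotate_left
  · exact hc1.aestronglyMeasurable.mul ((EuclideanSpace.proj i : Euc N →L[ℝ] ℝ).continuous.comp_aestronglyMeasurable
      (hΨ.continuous.comp_aestronglyMeasurable hVi.aestronglyMeasurable))
  · exact (hc1.mul ((EuclideanSpace.proj i : Euc N →L[ℝ] ℝ).continuous.comp
      (hΨ.continuous.comp (hVjs j).continuous))).integrable_of_hasCompactSupport
      (hφc.fderiv_apply ℝ _).mul_right
  have S2 := tendsto_integral_of_L1 _ ?_ (Eventually.of_forall fun j => ?_) T2
  rotate_left
  · exact hφ.continuous.aestronglyMeasurable.mul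
      ((EuclideanSpace.proj (i, k) : EucMat N n →L[ℝ] ℝ).continuous.comp_aestronglyMeasurable
      (hmm hVi.aestronglyMeasurable hWi.aestronglyMeasurable))
  · exact (hφ.continuous.mul ((EuclideanSpace.proj (i, k) : EucMat N n →L[ℝ] ℝ).continuous.comp
      (continuous_matMap.comp ((hA.comp (hVjs j).continuous).prodMk
        (hWjs j).continuous)))).integrable_of_hasCompactSupport hφc.mul_right
  have hlim := tendsto_nhds_unique S1 (S2.neg.congr fun j => (hparts j).symm)
  rw [setIntegral_eq_integral_of_tsupport_subset hφU
    (fun y hy => by simp [fderiv_eq_zero_of_notMem_tsupport hy]),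
    setIntegral_eq_integral_of_tsupport_subset hφU
    (fun y hy => by simp [image_eq_zero_of_notMem_tsupport hy])]
  have hin : ∀ x ∈ tsupport φ, x ∈ K' := fun x hx => interior_subset (hKK' hx)
  refine Eq.trans (integral_congr_ae (Eventually.of_forall fun x => ?_)) (hlim.trans
    (congrArg Neg.neg (integral_congr_ae (Eventually.of_forall fun x => ?_))))
  · by_cases hx : x ∈ tsupport φ
    · simp [hV, Set.indicator_of_mem (hin x hx)]
    · simp [fderiv_eq_zero_of_notMem_tsupport hx]
  · by_cases hx : x ∈ tsupport φ
    · simp [hV, hW, Set.indicator_of_mem (hin x hx)]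
    · simp [image_eq_zero_of_notMem_tsupport hx]

/-! ### The radial projection and its regularization -/

/-- A smooth regularization of the norm. -/
noncomputable def regNorm {N : ℕ} (ε : ℝ) (y : Euc N) : ℝ := √(‖y‖ ^ 2 + ε ^ 2)

/-- A smooth regularization of `y / |y|`. -/
noncomputable def regProj {N : ℕ} (ε : ℝ) (y : Euc N) : Euc N := (regNorm ε y)⁻¹ • y

/-- The derivative of `regProj ε` at `y`. -/
noncomputable def regDeriv {N : ℕ} (ε : ℝ) (y : Euc N) : Euc N →L[ℝ] Euc N :=
  (regNorm ε y)⁻¹ • ContinuousLinearMap.id ℝ (Euc N)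
    - (regNorm ε y)⁻¹ ^ 3 • (innerSL ℝ y).smulRight y

/-- The derivative of `y / |y|` at `y` applied to the columns of `ζ`. -/
noncomputable def radGrad {n N : ℕ} (y : Euc N) (ζ : EucMat N n) : EucMat N n :=
  matMap (regDeriv 0 y) ζ

theorem regDeriv_apply {N : ℕ} (ε : ℝ) (y η : Euc N) :
    regDeriv ε y η = (regNorm ε y)⁻¹ • η - ((regNorm ε y)⁻¹ ^ 3 * inner ℝ y η) • y := by
  simp [regDeriv, mul_smul]

@[simp] theorem regNorm_zero {N : ℕ} (y : Euc N) : regNorm 0 y = ‖y‖ := by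
  simp [regNorm]

theorem norm_le_regNorm {N : ℕ} (ε : ℝ) (y : Euc N) : ‖y‖ ≤ regNorm ε y :=
  Real.le_sqrt_of_sq_le (by nlinarith [sq_nonneg ε])

theorem abs_le_regNorm {N : ℕ} (ε : ℝ) (y : Euc N) : |ε| ≤ regNorm ε y :=
  Real.le_sqrt_of_sq_le (by rw [sq_abs]; nlinarith [sq_nonneg ‖y‖])

theorem regNorm_nonneg {N : ℕ} (ε : ℝ) (y : Euc N) : 0 ≤ regNorm ε y := Real.sqrt_nonneg _

theorem regNorm_pos {N : ℕ} {ε : ℝ} (hε : ε ≠ 0) (y : Euc N) : 0 < regNorm ε y :=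
  (abs_pos.2 hε).trans_le (abs_le_regNorm ε y)

theorem norm_regProj_le {N : ℕ} (ε : ℝ) (y : Euc N) : ‖regProj ε y‖ ≤ 1 := by
  rw [regProj, norm_smul, norm_inv, Real.norm_of_nonneg (regNorm_nonneg ε y), inv_mul_eq_div]
  exact div_le_one_of_le₀ (norm_le_regNorm ε y) (regNorm_nonneg ε y)

theorem norm_regDeriv_le {N : ℕ} (ε : ℝ) (y : Euc N) :
    ‖regDeriv ε y‖ ≤ 2 * (regNorm ε y)⁻¹ := by
  have hs := regNorm_nonneg ε y
  have hi := inv_nonneg.2 hs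
  refine ContinuousLinearMap.opNorm_le_bound _ (by positivity) fun η => ?_
  rw [regDeriv_apply]
  refine (norm_sub_le _ _).trans ?_
  rw [norm_smul, norm_smul, Real.norm_of_nonneg hi, norm_mul, Real.norm_of_nonneg (by positivity)]
  have h1 : (regNorm ε y)⁻¹ * ‖y‖ ≤ 1 := by
    rw [inv_mul_eq_div]; exact div_le_one_of_le₀ (norm_le_regNorm ε y) hs
  have h2 : ‖inner ℝ y η‖ ≤ ‖y‖ * ‖η‖ := norm_inner_le_norm y η
  calc (regNorm ε y)⁻¹ * ‖η‖ + (regNorm ε y)⁻¹ ^ 3 * ‖inner ℝ y η‖ * ‖y‖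
      ≤ (regNorm ε y)⁻¹ * ‖η‖ + (regNorm ε y)⁻¹ ^ 3 * (‖y‖ * ‖η‖) * ‖y‖ := by gcongr
    _ = (regNorm ε y)⁻¹ * ‖η‖ * (1 + ((regNorm ε y)⁻¹ * ‖y‖) ^ 2) := by ring
    _ ≤ (regNorm ε y)⁻¹ * ‖η‖ * (1 + 1 ^ 2) := by gcongr
    _ = 2 * (regNorm ε y)⁻¹ * ‖η‖ := by ring

theorem norm_regDeriv_le_of_ne {N : ℕ} (ε : ℝ) {y : Euc N} (hy : y ≠ 0) :
    ‖regDeriv ε y‖ ≤ 2 * ‖y‖⁻¹ := by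
  refine (norm_regDeriv_le ε y).trans ?_
  have := norm_pos_iff.2 hy
  gcongr
  exact norm_le_regNorm ε y

theorem norm_radGrad_le {n N : ℕ} (y : Euc N) (ζ : EucMat N n) :
    ‖radGrad y ζ‖ ≤ 2 * ‖y‖⁻¹ * ‖ζ‖ := by
  refine (norm_matMap_le _ _).trans ?_
  gcongr
  simpa using norm_regDeriv_le 0 y

theorem contDiff_regProj {N : ℕ} {ε : ℝ} (hε : ε ≠ 0) : ContDiff ℝ 1 (regProj (N := N) ε) := by
  have h : ∀ y : Euc N, ‖y‖ ^ 2 + ε ^ 2 ≠ 0 := fun y => by positivity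
  have h1 : ContDiff ℝ 1 fun y : Euc N => √(‖y‖ ^ 2 + ε ^ 2) :=
    ((contDiff_norm_sq ℝ).add contDiff_const).sqrt h
  exact (h1.inv fun y => (regNorm_pos hε y).ne').smul contDiff_id

theorem hasFDerivAt_regProj {N : ℕ} {ε : ℝ} (hε : ε ≠ 0) (y : Euc N) :
    HasFDerivAt (regProj ε) (regDeriv ε y) y := by
  have h : ‖y‖ ^ 2 + ε ^ 2 ≠ 0 := by positivity
  have hs : regNorm ε y ≠ 0 := (regNorm_pos hε y).ne'
  have h1 : HasFDerivAt (fun y : Euc N => ‖y‖ ^ 2 + ε ^ 2) (2 • innerSL ℝ y) y :=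
    ((hasStrictFDerivAt_norm_sq y).hasFDerivAt).add_const _
  have h2 : HasFDerivAt (regNorm ε) ((1 / (2 * regNorm ε y)) • (2 • innerSL ℝ y)) y :=
    h1.sqrt h
  have h3 := (hasDerivAt_inv hs).comp_hasFDerivAt y h2
  have h4 := h3.smul (hasFDerivAt_id y)
  refine h4.congr_fderiv ?_
  ext1 η
  simp only [regDeriv_apply, add_apply, smul_apply,
    ContinuousLinearMap.smulRight_apply, Function.comp_apply, id, ContinuousLinearMap.id_apply,
    innerSL_apply_apply, smul_eq_mul, nsmul_eq_mul, Nat.cast_ofNat]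
  rw [sub_eq_add_neg, ← neg_smul]
  congr 2
  field_simp

theorem tendsto_inv_regNorm {ι : Type*} {l : Filter ι} {N : ℕ} {e : ι → ℝ} {g : ι → Euc N}
    {y : Euc N} (he : Tendsto e l (𝓝 0)) (hg : Tendsto g l (𝓝 y)) (hy : y ≠ 0) :
    Tendsto (fun i => (regNorm (e i) (g i))⁻¹) l (𝓝 (regNorm 0 y)⁻¹) := by
  refine Tendsto.inv₀ ?_ (by simpa using hy)
  unfold regNorm
  exact ((hg.norm.pow 2).add (he.pow 2)).sqrt

theorem tendsto_regProj {ι : Type*} {l : Filter ι} {N : ℕ} {e : ι → ℝ} {g : ι → Euc N}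
    {y : Euc N} (he : Tendsto e l (𝓝 0)) (hg : Tendsto g l (𝓝 y)) (hy : y ≠ 0) :
    Tendsto (fun i => regProj (e i) (g i)) l (𝓝 (regProj 0 y)) :=
  (tendsto_inv_regNorm he hg hy).smul hg

theorem tendsto_regDeriv {ι : Type*} {l : Filter ι} {N : ℕ} {e : ι → ℝ} {g : ι → Euc N}
    {y : Euc N} (he : Tendsto e l (𝓝 0)) (hg : Tendsto g l (𝓝 y)) (hy : y ≠ 0) :
    Tendsto (fun i => regDeriv (e i) (g i)) l (𝓝 (regDeriv 0 y)) := by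
  have h1 := tendsto_inv_regNorm he hg hy
  have h2 : Continuous fun y : Euc N => (innerSL ℝ y).smulRight y := by fun_prop
  exact (h1.smul_const _).sub ((h1.pow 3).smul ((h2.tendsto y).comp hg))

theorem tendsto_radGrad {ι : Type*} {l : Filter ι} {n N : ℕ} {g : ι → Euc N} {z : ι → EucMat N n}
    {y : Euc N} {ζ : EucMat N n} (hg : Tendsto g l (𝓝 y)) (hz : Tendsto z l (𝓝 ζ)) (hy : y ≠ 0) :
    Tendsto (fun i => radGrad (g i) (z i)) l (𝓝 (radGrad y ζ)) := by
  have h1 := tendsto_regDeriv (tendsto_const_nhds (x := (0 : ℝ))) hg hy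
  exact (continuous_matMap.tendsto (regDeriv 0 y, ζ)).comp (h1.prodMk_nhds hz)

theorem measurable_regDeriv {N : ℕ} (ε : ℝ) : Measurable (regDeriv (N := N) ε) := by
  have h0 : Measurable fun y : Euc N => (regNorm ε y)⁻¹ := by unfold regNorm; fun_prop
  have h2 : Continuous fun y : Euc N => (innerSL ℝ y).smulRight y := by fun_prop
  exact (h0.smul_const _).sub ((h0.pow_const 3).smul h2.measurable)

theorem measurable_radGrad {n N : ℕ} {α : Type*} [MeasurableSpace α] {g : α → Euc N}
    {z : α → EucMat N n} (hg : Measurable g) (hz : Measurable z) :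
    Measurable fun x => radGrad (g x) (z x) :=
  continuous_matMap.measurable.comp (((measurable_regDeriv 0).comp hg).prodMk hz)

/-! ### Sobolev regularity of projections from almost every centre -/

/-- The integrand is at most `1` when `|y - a| ≥ 1`, and the rest is bounded, after translation, by
the integral of `|z|^{-q}` over the unit ball, finite for `q < N`. Neither bound depends on `y`. -/
theorem exists_lintegral_inv_norm_rpow_le {N : ℕ} {q : ℝ} (hq0 : 0 ≤ q) (hq : q < N) :
    ∃ c : ℝ≥0∞, c ≠ ⊤ ∧ ∀ y : Euc N,
      ∫⁻ a in Metric.ball (0 : Euc N) (1 / 2), ENNReal.ofReal (‖y - a‖⁻¹ ^ q) ≤ c := by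
  have hN : 1 ≤ Module.finrank ℝ (Euc N) := by
    have : (0 : ℝ) < N := hq0.trans_lt hq
    simpa using Nat.one_le_iff_ne_zero.2 (fun h => by simp [h] at this)
  set h : Euc N → ℝ := fun z => ‖z‖⁻¹ ^ q with hh
  have hm : Measurable h := (measurable_norm.inv).pow_const q
  have hint : IntegrableOn h (Metric.ball 0 1) volume := by
    refine integrableOn_ball_of_norm_le_rpow hN (C := 1) (α := q) (by simpa using hq) ?_
      hm.aestronglyMeasurable
    refine Eventually.of_forall fun z => ?_
    rw [one_mul, Real.rpow_neg (norm_nonneg _), ← Real.inv_rpow (norm_nonneg _),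
      Real.norm_of_nonneg (by positivity)]
  refine ⟨(∫⁻ z in Metric.ball (0 : Euc N) 1, ENNReal.ofReal (h z))
    + volume (Metric.ball (0 : Euc N) (1 / 2)), ?_, fun y => ?_⟩
  · refine ENNReal.add_ne_top.2 ⟨?_, measure_ball_lt_top.ne⟩
    have := hint.hasFiniteIntegral
    rw [hasFiniteIntegral_iff_ofReal (Eventually.of_forall fun z => by positivity)] at this
    exact this.ne
  · set g : Euc N → ℝ≥0∞ :=
      (Metric.ball (0 : Euc N) 1).indicator (fun z => ENNReal.ofReal (h z)) with hg
    have hgm : Measurable g := hm.ennreal_ofReal.indicator measurableSet_ball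
    have hle : ∀ a, ENNReal.ofReal (‖y - a‖⁻¹ ^ q) ≤ g (y - a) + 1 := by
      intro a
      by_cases ha : ‖y - a‖ < 1
      · have : g (y - a) = ENNReal.ofReal (‖y - a‖⁻¹ ^ q) :=
          Set.indicator_of_mem (by simpa using ha) _
        rw [this]; exact le_self_add
      · refine le_add_left ?_
        rw [ENNReal.ofReal_le_one]
        exact Real.rpow_le_one (by positivity) (inv_le_one_of_one_le₀ (not_lt.1 ha)) hq0
    calc ∫⁻ a in Metric.ball (0 : Euc N) (1 / 2), ENNReal.ofReal (‖y - a‖⁻¹ ^ q)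
        ≤ ∫⁻ a in Metric.ball (0 : Euc N) (1 / 2), (g (y - a) + 1) :=
          lintegral_mono fun a => hle a
      _ = (∫⁻ a in Metric.ball (0 : Euc N) (1 / 2), g (y - a))
          + volume (Metric.ball (0 : Euc N) (1 / 2)) := by
          rw [lintegral_add_right _ measurable_const]; simp
      _ ≤ (∫⁻ a, g (y - a)) + volume (Metric.ball (0 : Euc N) (1 / 2)) := by
          gcongr; exact Measure.restrict_le_self
      _ = _ := by
          rw [lintegral_sub_left_eq_self g y, hg, lintegral_indicator measurableSet_ball]

theorem HasWeakGrad.regProj_sub {n N : ℕ} {U : Set (Euc n)} {v : Euc n → Euc N}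
    {Dv : Euc n → EucMat N n} (h : HasWeakGrad U v Dv) (hU : IsOpen U) {ε : ℝ} (hε : ε ≠ 0)
    (a : Euc N) :
    HasWeakGrad U (fun x => regProj ε (v x - a))
      (fun x => matMap (regDeriv ε (v x - a)) (Dv x)) := by
  have hd : ∀ y, HasFDerivAt (fun y => regProj ε (y - a)) (regDeriv ε (y - a)) y := fun y => by
    have := (hasFDerivAt_regProj hε (y - a)).comp y ((hasFDerivAt_id y).sub_const a)
    exact this
  have := h.comp_of_fderiv_le hU (Ψ := fun y => regProj ε (y - a))
    ((contDiff_regProj hε).comp (contDiff_id.sub contDiff_const)) (L := 2 * |ε|⁻¹) fun y => by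
      rw [(hd y).fderiv]
      refine (norm_regDeriv_le _ _).trans ?_
      have := abs_pos.2 hε
      gcongr
      exact abs_le_regNorm _ _
  simpa only [(hd _).fderiv] using this

/-- Fubini on the graph of `v`: for each `x` the only bad centre is `v x`, and points are null in
positive dimension. -/
theorem ae_ae_ne {n N : ℕ} (hN : 0 < N) {U : Set (Euc n)} {v : Euc n → Euc N}
    (hv : Measurable v) (B : Set (Euc N)) :
    ∀ᵐ a ∂volume.restrict B, ∀ᵐ x ∂volume.restrict U, v x ≠ a := by
  have : Nontrivial (Euc N) := by
    have : Nonempty (Fin N) := ⟨⟨0, hN⟩⟩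
    infer_instance
  have hm : MeasurableSet {z : Euc n × Euc N | v z.1 ≠ z.2} :=
    (measurableSet_eq_fun (hv.comp measurable_fst) measurable_snd).compl
  refine (Measure.ae_ae_comm hm).1 (Eventually.of_forall fun x => ?_)
  have h0 : volume.restrict B {v x} = 0 :=
    le_antisymm ((Measure.restrict_le_self _).trans_eq (by simp)) zero_le
  have := measure_eq_zero_iff_ae_notMem.1 h0
  filter_upwards [this] with a ha h
  exact ha h.symm

/-- By Tonelli, integrating the `q`-th power in `a` first leaves a constant times `∫ ‖Dv‖^q`, so the
integral in `x` is finite for almost every `a`. -/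
theorem ae_memLp_inv_norm_mul {n N : ℕ} {q : ℝ} (hq1 : 1 ≤ q) (hqN : q < N)
    {U : Set (Euc n)} {v : Euc n → Euc N} {Dv : Euc n → EucMat N n} (hv : Measurable v)
    (hDv : Measurable Dv) (hDvq : MemLp Dv (ENNReal.ofReal q) (volume.restrict U)) :
    ∀ᵐ a ∂volume.restrict (Metric.ball (0 : Euc N) (1 / 2)),
      MemLp (fun x => ‖v x - a‖⁻¹ * ‖Dv x‖) (ENNReal.ofReal q) (volume.restrict U) := by
  have hq0 : 0 < q := by linarith
  have hqE : ENNReal.ofReal q ≠ 0 := by simpa using hq0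
  obtain ⟨c, hc, hcb⟩ := exists_lintegral_inv_norm_rpow_le hq0.le hqN
  have hfin := (eLpNorm_lt_top_iff_lintegral_rpow_enorm_lt_top hqE ENNReal.ofReal_ne_top).1
    hDvq.eLpNorm_lt_top
  rw [ENNReal.toReal_ofReal hq0.le] at hfin
  set F : Euc N → Euc n → ℝ≥0∞ := fun a x => ENNReal.ofReal (‖v x - a‖⁻¹ ^ q) * ‖Dv x‖ₑ ^ q
  have hFm : Measurable (Function.uncurry F) := by
    have h1 : Measurable fun z : Euc N × Euc n => ‖v z.2 - z.1‖⁻¹ ^ q :=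
      (((hv.comp measurable_snd).sub measurable_fst).norm.inv).pow_const q
    exact h1.ennreal_ofReal.mul ((hDv.comp measurable_snd).enorm.pow_const q)
  have hlt : ∫⁻ a in Metric.ball (0 : Euc N) (1 / 2), ∫⁻ x in U, F a x < ⊤ := by
    rw [lintegral_lintegral_swap hFm.aemeasurable]
    refine lt_of_le_of_lt (lintegral_mono (g := fun x => c * ‖Dv x‖ₑ ^ q) fun x => ?_) ?_
    · have h1 : Measurable fun a => ENNReal.ofReal (‖v x - a‖⁻¹ ^ q) :=
        ((((measurable_const (a := v x)).sub measurable_id).norm.inv).pow_const q).ennreal_ofReal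
      simp only [F]
      rw [lintegral_mul_const _ h1]
      gcongr
      exact hcb (v x)
    · rw [lintegral_const_mul _ (hDv.enorm.pow_const q)]
      exact ENNReal.mul_lt_top hc.lt_top hfin
  have hae := ae_lt_top (hFm.lintegral_prod_right' ) hlt.ne
  filter_upwards [hae] with a ha
  refine ⟨(((hv.sub_const a).norm.inv).mul hDv.norm).aestronglyMeasurable, ?_⟩
  rw [eLpNorm_lt_top_iff_lintegral_rpow_enorm_lt_top hqE ENNReal.ofReal_ne_top,
    ENNReal.toReal_ofReal hq0.le]
  refine lt_of_le_of_lt (lintegral_mono fun x => ?_) ha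
  simp only [F, Function.uncurry]
  rw [enorm_mul, ENNReal.mul_rpow_of_nonneg _ _ hq0.le, enorm_norm,
    ← ENNReal.ofReal_rpow_of_nonneg (by positivity) hq0.le,
    Real.enorm_of_nonneg (by positivity)]

theorem radialProj_eq {n N : ℕ} (v : Euc n → Euc N) (a : Euc N) :
    radialProj v a = fun x => regProj 0 (v x - a) := by
  funext x; simp [radialProj, regProj]

/-- Radial projections of a Sobolev map from almost every centre are Sobolev maps. -/
theorem ae_hasWeakGrad_radialProj {n N : ℕ} {q : ℝ} (hq1 : 1 ≤ q) (hqN : q < N)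
    {U : Set (Euc n)} (hU : IsOpen U) (hUb : Bornology.IsBounded U) {v : Euc n → Euc N}
    {Dv : Euc n → EucMat N n} (hv : Measurable v) (hDv : Measurable Dv)
    (hDvq : MemLp Dv (ENNReal.ofReal q) (volume.restrict U)) (h : HasWeakGrad U v Dv) :
    ∀ᵐ a ∂volume.restrict (Metric.ball (0 : Euc N) (1 / 2)),
      (∀ᵐ x ∂volume.restrict U, v x ≠ a) ∧
      MemLp (fun x => radGrad (v x - a) (Dv x)) (ENNReal.ofReal q) (volume.restrict U) ∧
      HasWeakGrad U (radialProj v a) (fun x => radGrad (v x - a) (Dv x)) := by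
  have hN : 0 < N := by
    have : (0 : ℝ) < N := by linarith
    exact_mod_cast this
  have hfin : IsFiniteMeasure (volume.restrict U) :=
    ⟨by simpa using hUb.measure_lt_top⟩
  have hqE : 1 ≤ ENNReal.ofReal q := by simpa using hq1
  filter_upwards [ae_ae_ne hN hv (U := U) (Metric.ball (0 : Euc N) (1 / 2)),
    ae_memLp_inv_norm_mul hq1 hqN hv hDv hDvq] with a hne hg
  have hgi : Integrable (fun x => ‖v x - a‖⁻¹ * ‖Dv x‖) (volume.restrict U) := hg.integrable hqE
  have hT : Measurable fun x => radGrad (v x - a) (Dv x) :=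
    measurable_radGrad (hv.sub_const a) hDv
  have hTq : MemLp (fun x => radGrad (v x - a) (Dv x)) (ENNReal.ofReal q) (volume.restrict U) := by
    refine (hg.const_mul 2).mono hT.aestronglyMeasurable (Eventually.of_forall fun x => ?_)
    refine (norm_radGrad_le _ _).trans ?_
    rw [mul_assoc]
    exact le_abs_self _
  refine ⟨hne, hTq, ?_, ?_, ?_⟩
  · have hm : AEStronglyMeasurable (radialProj v a) (volume.restrict U) :=
      (((hv.sub_const a).norm.inv).smul (hv.sub_const a)).aestronglyMeasurable
    have : IntegrableOn (radialProj v a) U volume := by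
      refine Integrable.mono' (integrable_const (1 : ℝ)) hm (Eventually.of_forall fun x => ?_)
      rw [radialProj_eq]
      exact norm_regProj_le _ _
    exact this.locallyIntegrableOn
  · have : IntegrableOn (fun x => radGrad (v x - a) (Dv x)) U volume := hTq.integrable hqE
    exact this.locallyIntegrableOn
  intro φ hφ hφc hφU i k
  -- The weak identity holds for the regularized projections and passes to the limit: values are
  -- bounded by `1`, gradients by `2 ‖v - a‖⁻¹ ‖Dv‖` uniformly in the regularization, and this bound
  -- is integrable.
  set e : ℕ → ℝ := fun j => 1 / ((j : ℝ) + 1) with he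
  have hepos : ∀ j, e j ≠ 0 := fun j => by positivity
  have he0 : Tendsto e atTop (𝓝 0) := tendsto_one_div_add_atTop_nhds_zero_nat
  have hparts := fun j => (h.regProj_sub hU (hepos j) a).2.2 φ hφ hφc hφU i k
  obtain ⟨c, hc⟩ := hφc.exists_bound_of_continuous hφ.continuous
  have hc1 : Continuous fun x => fderiv ℝ φ x (EuclideanSpace.single k 1) :=
    (hφ.continuous_fderiv (by simp)).clm_apply continuous_const
  obtain ⟨c', hc'⟩ := (hφc.fderiv_apply ℝ (EuclideanSpace.single k 1)).exists_bound_of_continuous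
    hc1
  have hpi : Measurable fun y : Euc N => y i :=
    (EuclideanSpace.proj i : Euc N →L[ℝ] ℝ).continuous.measurable
  have hpik : Measurable fun ζ : EucMat N n => ζ (i, k) :=
    (EuclideanSpace.proj (i, k) : EucMat N n →L[ℝ] ℝ).continuous.measurable
  have L1 : Tendsto (fun j => ∫ x in U, fderiv ℝ φ x (EuclideanSpace.single k 1)
      * regProj (e j) (v x - a) i) atTop
      (𝓝 (∫ x in U, fderiv ℝ φ x (EuclideanSpace.single k 1) * radialProj v a x i)) := by
    refine tendsto_integral_of_dominated_convergence (fun _ => c') (fun j => ?_)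
      (integrable_const _) (fun j => Eventually.of_forall fun x => ?_) ?_
    · have hm : Measurable fun x => regProj (e j) (v x - a) :=
        (contDiff_regProj (hepos j)).continuous.measurable.comp (hv.sub_const a)
      exact (hc1.measurable.mul (hpi.comp hm)).aestronglyMeasurable
    · rw [norm_mul]
      have h1 : ‖regProj (e j) (v x - a) i‖ ≤ 1 :=
        (norm_apply_le_norm _ _).trans (norm_regProj_le _ _)
      calc _ ≤ c' * 1 := mul_le_mul (hc' x) h1 (norm_nonneg _) ((norm_nonneg _).trans (hc' x))
        _ = c' := mul_one _
    · filter_upwards [hne] with x hx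
      rw [radialProj_eq]
      have h1 := tendsto_regProj he0 (tendsto_const_nhds (x := v x - a)) (sub_ne_zero.2 hx)
      exact (((EuclideanSpace.proj i : Euc N →L[ℝ] ℝ).continuous.tendsto _).comp h1).const_mul _
  have L2 : Tendsto (fun j => ∫ x in U, φ x * matMap (regDeriv (e j) (v x - a)) (Dv x) (i, k)) atTop
      (𝓝 (∫ x in U, φ x * radGrad (v x - a) (Dv x) (i, k))) := by
    refine tendsto_integral_of_dominated_convergence
      (fun x => c * (2 * (‖v x - a‖⁻¹ * ‖Dv x‖))) (fun j => ?_)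
      ((hgi.const_mul 2).const_mul c) (fun j => ?_) ?_
    · have hm : Measurable fun x => matMap (regDeriv (e j) (v x - a)) (Dv x) :=
        continuous_matMap.measurable.comp
          (((measurable_regDeriv (e j)).comp (hv.sub_const a)).prodMk hDv)
      exact (hφ.continuous.measurable.mul (hpik.comp hm)).aestronglyMeasurable
    · filter_upwards [hne] with x hx
      rw [norm_mul]
      have h1 : ‖matMap (regDeriv (e j) (v x - a)) (Dv x) (i, k)‖
          ≤ 2 * (‖v x - a‖⁻¹ * ‖Dv x‖) := by
        refine (norm_apply_le_norm _ _).trans ((norm_matMap_le _ _).trans ?_)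
        rw [← mul_assoc]
        gcongr
        exact norm_regDeriv_le_of_ne _ (sub_ne_zero.2 hx)
      exact mul_le_mul (hc x) h1 (norm_nonneg _) ((norm_nonneg _).trans (hc x))
    · filter_upwards [hne] with x hx
      have h1 := tendsto_regDeriv he0 (tendsto_const_nhds (x := v x - a)) (sub_ne_zero.2 hx)
      have h2 := (continuous_matMap.tendsto (regDeriv 0 (v x - a), Dv x)).comp
        (h1.prodMk_nhds tendsto_const_nhds)
      exact (((EuclideanSpace.proj (i, k) : EucMat N n →L[ℝ] ℝ).continuous.tendsto _).comp
        h2).const_mul _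
  exact tendsto_nhds_unique L1 (L2.neg.congr fun j => (hparts j).symm)

/-! ### The averaged projection condition at a point -/

/-- The affine map with value `b` at the origin and gradient `ζ`. -/
noncomputable def affineMap {n N : ℕ} (b : Euc N) (ζ : EucMat N n) (x : Euc n) : Euc N :=
  b + ∑ k, x k • matCol ζ k

theorem hasFDerivAt_affineMap {n N : ℕ} (b : Euc N) (ζ : EucMat N n) (x : Euc n) :
    HasFDerivAt (affineMap b ζ)
      (∑ k, (EuclideanSpace.proj k : Euc n →L[ℝ] ℝ).smulRight (matCol ζ k)) x := by
  unfold affineMap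
  refine HasFDerivAt.const_add _ (HasFDerivAt.fun_sum fun k _ => ?_)
  exact ((EuclideanSpace.proj k : Euc n →L[ℝ] ℝ).smulRight (matCol ζ k)).hasFDerivAt

theorem contDiff_affineMap {n N : ℕ} (b : Euc N) (ζ : EucMat N n) :
    ContDiff ℝ 1 (affineMap b ζ) := by
  unfold affineMap
  refine contDiff_const.add (ContDiff.sum fun k _ => ?_)
  exact ((EuclideanSpace.proj k : Euc n →L[ℝ] ℝ).smulRight (matCol ζ k)).contDiff

theorem continuous_affineMap_left {n N : ℕ} (x : Euc n) :
    Continuous fun z : Euc N × EucMat N n => affineMap z.1 z.2 x := by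
  have h : ∀ k, Continuous fun ζ : EucMat N n => matCol ζ k := fun k => by
    unfold matCol; fun_prop
  unfold affineMap
  exact continuous_fst.add (continuous_finsetSum _ fun k _ =>
    ((h k).comp continuous_snd).const_smul (x k))

theorem hasWeakGrad_affineMap {n N : ℕ} (U : Set (Euc n)) (b : Euc N) (ζ : EucMat N n) :
    HasWeakGrad U (affineMap b ζ) (fun _ => ζ) := by
  refine ⟨(contDiff_affineMap b ζ).continuous.locallyIntegrable.locallyIntegrableOn U,
    (locallyIntegrable_const ζ).locallyIntegrableOn U, fun φ hφ hφc hφU i k => ?_⟩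
  rw [setIntegral_eq_integral_of_tsupport_subset hφU
    (fun y hy => by simp [fderiv_eq_zero_of_notMem_tsupport hy]),
    setIntegral_eq_integral_of_tsupport_subset hφU
    (fun y hy => by simp [image_eq_zero_of_notMem_tsupport hy])]
  have := integral_mul_fderiv_comp_eq hφ hφc (Ψ := id) contDiff_id (contDiff_affineMap b ζ)
    (W := fun _ => ζ) (fun x _ k i => by
      rw [(hasFDerivAt_affineMap b ζ x).fderiv]
      simp) i k
  simpa using this

theorem memW1pLoc_affineMap {n N : ℕ} (p : ℝ) (Ω : Set (Euc n)) (b : Euc N) (ζ : EucMat N n) :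
    MemW1pLoc p Ω (affineMap b ζ) (fun _ => ζ) := by
  intro V _ hV _
  have hfin : IsFiniteMeasure (volume.restrict V) :=
    ⟨by simpa using (measure_mono subset_closure).trans_lt hV.measure_lt_top⟩
  have hc := (contDiff_affineMap b ζ).continuous
  obtain ⟨c, hcb⟩ := hV.exists_bound_of_continuousOn hc.continuousOn
  refine ⟨MemLp.of_bound hc.aestronglyMeasurable c ?_, memLp_const _, hasWeakGrad_affineMap V b ζ⟩
  exact ae_restrict_of_ae_restrict_of_subset subset_closure
    ((ae_restrict_iff' hV.isClosed.measurableSet).2 (Eventually.of_forall hcb))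

/-- The averaged projection bound in pointwise form. -/
theorem AveragedProjectionBound.pointwise {n N : ℕ} {p : ℝ} {Ω : Set (Euc n)}
    {f : Euc n → EucMat N n → ℝ} (hf : AveragedProjectionBound p Ω f) (hp : 1 ≤ p) (hpN : p < N)
    (hΩ : IsOpen Ω) (hΩb : Bornology.IsBounded Ω) (hcont : ∀ x ∈ Ω, Continuous (f x)) :
    ∃ K : ℝ, 0 < K ∧ ∀ᵐ x ∂volume.restrict Ω, ∀ (b : Euc N) (ζ : EucMat N n),
      ∫⁻ a in Metric.ball (0 : Euc N) (1 / 2), ENNReal.ofReal (f x (radGrad (b - a) ζ))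
        ≤ ENNReal.ofReal (K * (f x ζ + 1)) := by
  obtain ⟨K, hK, hKb⟩ := hf
  have hN : 0 < N := by
    have : (0 : ℝ) < N := by linarith
    exact_mod_cast this
  have : Nontrivial (Euc N) := by
    have : Nonempty (Fin N) := ⟨⟨0, hN⟩⟩
    infer_instance
  have hfin : IsFiniteMeasure (volume.restrict Ω) :=
    ⟨by simpa using hΩb.measure_lt_top⟩
  refine ⟨K, hK, ?_⟩
  -- The null set in the averaged condition depends on the test map; countably many affine maps
  -- leave a single null set, and density recovers all values and gradients.
  set d := TopologicalSpace.denseSeq (Euc N × EucMat N n) with hd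
  have hcount : ∀ᵐ x ∂volume.restrict Ω, ∀ j : ℕ,
      ∫⁻ a in Metric.ball (0 : Euc N) (1 / 2),
        ENNReal.ofReal (f x (radGrad (affineMap (d j).1 (d j).2 x - a) (d j).2))
        ≤ ENNReal.ofReal (K * (f x (d j).2 + 1)) := by
    refine ae_all_iff.2 fun j => ?_
    have hv := (contDiff_affineMap (d j).1 (d j).2).continuous.measurable
    refine hKb _ _ (memW1pLoc_affineMap p Ω (d j).1 (d j).2)
      (fun a x => radGrad (affineMap (d j).1 (d j).2 x - a) (d j).2) ?_ ?_
    · exact (measurable_radGrad ((hv.comp measurable_fst).sub measurable_snd)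
        measurable_const).aestronglyMeasurable
    · filter_upwards [ae_hasWeakGrad_radialProj hp hpN hΩ hΩb hv measurable_const
        (memLp_const (d j).2) (hasWeakGrad_affineMap Ω (d j).1 (d j).2)] with a ha using ha.2.2
  filter_upwards [hcount, ae_restrict_mem hΩ.measurableSet] with x hx hxΩ b ζ
  have hfx := hcont x hxΩ
  -- The first component is chosen so that the limiting affine map takes the value `b` at `x`. The
  -- bound then survives by Fatou's lemma, the integrands converging for every `a ≠ b`.
  have hmem : (b - affineMap 0 ζ x, ζ) ∈ closure (Set.range d) := by
    rw [(TopologicalSpace.denseRange_denseSeq _).closure_range]; trivial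
  obtain ⟨y, hy, hylim⟩ := mem_closure_iff_seq_limit.1 hmem
  choose s hs using hy
  have hlim : Tendsto (fun j => d (s j)) atTop (𝓝 (b - affineMap 0 ζ x, ζ)) := by
    simpa only [hs] using hylim
  have hζ : Tendsto (fun j => (d (s j)).2) atTop (𝓝 ζ) :=
    (continuous_snd.tendsto _).comp hlim
  have hb : Tendsto (fun j => affineMap (d (s j)).1 (d (s j)).2 x) atTop (𝓝 b) := by
    have h1 := ((continuous_affineMap_left x).tendsto _).comp hlim
    have h2 : affineMap (b - affineMap 0 ζ x) ζ x = b := by simp [affineMap]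
    rw [h2] at h1
    exact h1
  have hR : Tendsto (fun j => ENNReal.ofReal (K * (f x (d (s j)).2 + 1))) atTop
      (𝓝 (ENNReal.ofReal (K * (f x ζ + 1)))) :=
    (ENNReal.continuous_ofReal.tendsto _).comp
      ((((hfx.tendsto ζ).comp hζ).add_const 1).const_mul K)
  have hm : ∀ (b : Euc N) (ζ : EucMat N n),
      Measurable fun a => ENNReal.ofReal (f x (radGrad (b - a) ζ)) := fun b ζ =>
    (hfx.measurable.comp (measurable_radGrad (measurable_id.const_sub b)
      measurable_const)).ennreal_ofReal
  calc ∫⁻ a in Metric.ball (0 : Euc N) (1 / 2), ENNReal.ofReal (f x (radGrad (b - a) ζ))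
      = ∫⁻ a in Metric.ball (0 : Euc N) (1 / 2), liminf (fun j => ENNReal.ofReal
          (f x (radGrad (affineMap (d (s j)).1 (d (s j)).2 x - a) (d (s j)).2))) atTop := by
        refine lintegral_congr_ae (ae_restrict_of_ae ?_)
        filter_upwards [measure_eq_zero_iff_ae_notMem.1 (measure_singleton (μ := volume) b)] with a ha
        have hne : b - a ≠ 0 := sub_ne_zero.2 fun h => ha h.symm
        have h1 := tendsto_radGrad (hb.sub_const a) hζ hne
        exact (((ENNReal.continuous_ofReal.comp hfx).tendsto _).comp h1).liminf_eq.symm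
    _ ≤ liminf (fun j => ∫⁻ a in Metric.ball (0 : Euc N) (1 / 2), ENNReal.ofReal
          (f x (radGrad (affineMap (d (s j)).1 (d (s j)).2 x - a) (d (s j)).2))) atTop :=
        lintegral_liminf_le fun j => hm _ _
    _ ≤ liminf (fun j => ENNReal.ofReal (K * (f x (d (s j)).2 + 1))) atTop :=
        liminf_le_liminf (Eventually.of_forall fun j => hx (s j))
    _ = _ := hR.liminf_eq

/-! ### From averages to a pointwise bound by convexity -/

/-- The mean value theorem on the segment from `η` to `ξ` produces the slope at an intermediate
point, which by monotonicity is at least the slope at `η`. -/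
theorem add_inner_gradient_le_of_monotone {E : Type*} [NormedAddCommGroup E]
    [InnerProductSpace ℝ E] [CompleteSpace E] {g : E → ℝ} (hg : Differentiable ℝ g)
    (hmono : ∀ x y, 0 ≤ inner ℝ (gradient g x - gradient g y) (x - y)) (η ξ : E) :
    g η + inner ℝ (gradient g η) (ξ - η) ≤ g ξ := by
  set w := ξ - η with hw
  have hd : ∀ t : ℝ, HasDerivAt (fun t : ℝ => g (η + t • w))
      (inner ℝ (gradient g (η + t • w)) w) t := by
    intro t
    have h1 : HasDerivAt (fun t : ℝ => η + t • w) w t := by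
      simpa using ((hasDerivAt_id t).smul_const w).const_add η
    have h2 := (hg (η + t • w)).hasGradientAt.hasFDerivAt.comp_hasDerivAt t h1
    exact h2
  obtain ⟨c, hc, hceq⟩ := exists_hasDerivAt_eq_slope (fun t : ℝ => g (η + t • w))
    (fun t => inner ℝ (gradient g (η + t • w)) w) zero_lt_one
    (fun t _ => (hd t).continuousAt.continuousWithinAt) (fun t _ => hd t)
  have h1 := hmono (η + c • w) η
  rw [add_sub_cancel_left, inner_smul_right, inner_sub_left] at h1
  have h2 := nonneg_of_mul_nonneg_right h1 hc.1
  have h3 : η + (1 : ℝ) • w = ξ := by simp [hw]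
  simp only [h3, zero_smul, add_zero, sub_zero, div_one] at hceq
  linarith

/-- `⟨Q, Tζ⟩` is the trace of `T ζ Qᵀ`, and for symmetric `T` only the symmetric part of `ζ Qᵀ`
matters. Diagonalizing that part gives a basis and weights that serve every `T` at once. The
operator `W` below is twice the symmetric part, hence the halved eigenvalues. -/
theorem exists_orthonormalBasis_inner_matMap {n N : ℕ} (Q ζ : EucMat N n) :
    ∃ (v : OrthonormalBasis (Fin N) ℝ (Euc N)) (l : Fin N → ℝ),
      ∀ T : Euc N →L[ℝ] Euc N, (∀ x y, inner ℝ (T x) y = inner ℝ x (T y)) →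
        inner ℝ Q (matMap T ζ) = ∑ i, l i * inner ℝ (v i) (T (v i)) := by
  set W : Euc N →ₗ[ℝ] Euc N := ∑ k, (((innerₛₗ ℝ (matCol ζ k)).smulRight (matCol Q k))
      + ((innerₛₗ ℝ (matCol Q k)).smulRight (matCol ζ k))) with hW
  have hWa : ∀ y, W y = ∑ k, (inner ℝ (matCol ζ k) y • matCol Q k
      + inner ℝ (matCol Q k) y • matCol ζ k) := fun y => by
    simp [hW]
  have hsym : W.IsSymmetric := by
    intro x y
    rw [hWa, hWa, sum_inner, inner_sum]
    refine Finset.sum_congr rfl fun k _ => ?_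
    simp only [inner_add_left, inner_add_right, real_inner_smul_left, real_inner_smul_right]
    rw [real_inner_comm x (matCol Q k), real_inner_comm x (matCol ζ k)]
    ring
  have hn : Module.finrank ℝ (Euc N) = N := by simp
  set v := hsym.eigenvectorBasis hn
  refine ⟨v, fun i => hsym.eigenvalues hn i / 2, fun T hT => ?_⟩
  have hv : ∀ i, W (v i) = hsym.eigenvalues hn i • v i := fun i =>
    hsym.apply_eigenvectorBasis hn i
  have e1 : inner ℝ Q (matMap T ζ)
      = ∑ k, ∑ i, inner ℝ (matCol Q k) (v i) * inner ℝ (v i) (T (matCol ζ k)) := by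
    rw [inner_eq_sum_matCol]
    exact Finset.sum_congr rfl fun k _ => by rw [v.sum_inner_mul_inner, matCol_matMap]
  have e2 : inner ℝ Q (matMap T ζ)
      = ∑ k, ∑ i, inner ℝ (T (matCol Q k)) (v i) * inner ℝ (v i) (matCol ζ k) := by
    rw [inner_eq_sum_matCol]
    exact Finset.sum_congr rfl fun k _ => by rw [v.sum_inner_mul_inner, matCol_matMap, hT]
  -- Both sides are the trace of `W T`: the two summands of `W` contribute equally, by the symmetry
  -- of `T`.
  have e3 : ∑ i, inner ℝ (W (v i)) (T (v i)) = inner ℝ Q (matMap T ζ) + inner ℝ Q (matMap T ζ) := by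
    nth_rewrite 1 [e1]
    rw [e2, Finset.sum_comm, Finset.sum_comm (s := Finset.univ (α := Fin n)),
      ← Finset.sum_add_distrib]
    refine Finset.sum_congr rfl fun i _ => ?_
    rw [hWa, sum_inner, ← Finset.sum_add_distrib]
    refine Finset.sum_congr rfl fun k _ => ?_
    rw [inner_add_left, real_inner_smul_left, real_inner_smul_left, hT (matCol Q k),
      ← hT (v i), real_inner_comm (matCol ζ k) (v i), real_inner_comm (matCol ζ k) (T (v i))]
    ring
  have e4 : ∑ i, inner ℝ (W (v i)) (T (v i))
      = 2 * ∑ i, hsym.eigenvalues hn i / 2 * inner ℝ (v i) (T (v i)) := by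
    rw [Finset.mul_sum]
    refine Finset.sum_congr rfl fun i _ => ?_
    rw [hv, real_inner_smul_left]
    ring
  linarith

/-- In the model case `m = 1`, `τ = 4` off `i₀` and `τ i₀ = 0`, the claim reads `S ≤ 4 (S - l i₀)`
with `S = ∑ l i > 0`; it holds because the minimum is at most the mean `S / N ≤ S / 2`. Subtracting
`l i₀` makes all weights nonnegative and the perturbation by `ε` harmless. -/
theorem sum_mul_le_sum_mul_of_close {N : ℕ} (hN : 2 ≤ N) {l m τ : Fin N → ℝ} {ε : ℝ}
    (hε0 : 0 ≤ ε) (hε : ε * N ≤ 1 / 10) {i₀ : Fin N} (hl : ∀ i, l i₀ ≤ l i)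
    (hm : ∀ i, |m i - 1| ≤ ε) (hτ : ∀ i, i ≠ i₀ → |τ i - 4| ≤ ε) (hτ0 : |τ i₀| ≤ ε)
    (hpos : 0 < ∑ i, l i * m i) : ∑ i, l i * m i ≤ ∑ i, l i * τ i := by
  have hN' : (2 : ℝ) ≤ N := by exact_mod_cast hN
  set t := ∑ i, (l i - l i₀) with ht
  have ht0 : 0 ≤ t := Finset.sum_nonneg fun i _ => sub_nonneg.2 (hl i)
  have a1 : (3 - 2 * ε) * t ≤ ∑ i, (l i - l i₀) * (τ i - m i) := by
    rw [ht, Finset.mul_sum]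
    refine Finset.sum_le_sum fun i _ => ?_
    by_cases hi : i = i₀
    · simp [hi]
    · have h1 := abs_le.1 (hm i)
      have h2 := abs_le.1 (hτ i hi)
      have h3 := hl i
      nlinarith [h1.2, h2.1]
  have a2 : ∑ i, (l i - l i₀) * m i ≤ (1 + ε) * t := by
    rw [ht, Finset.mul_sum]
    refine Finset.sum_le_sum fun i _ => ?_
    have h1 := abs_le.1 (hm i)
    have h3 := hl i
    nlinarith [h1.2]
  have hcard : ∀ c : ℝ, ∑ _i : Fin N, c = N * c := fun c => by simp
  have sm1 : N - 1 / 10 ≤ ∑ i, m i := by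
    have : ∑ _i : Fin N, (1 - ε) ≤ ∑ i, m i :=
      Finset.sum_le_sum fun i _ => by linarith [(abs_le.1 (hm i)).1]
    rw [hcard] at this
    linarith
  have sm2 : ∑ i, m i ≤ N + 1 / 10 := by
    have : ∑ i, m i ≤ ∑ _i : Fin N, (1 + ε) :=
      Finset.sum_le_sum fun i _ => by linarith [(abs_le.1 (hm i)).2]
    rw [hcard] at this
    linarith
  have hite : ∑ i : Fin N, (if i = i₀ then (0 : ℝ) else 4) = 4 * N - 4 := by
    have : ∀ i : Fin N, (if i = i₀ then (0 : ℝ) else 4) = 4 - if i = i₀ then 4 else 0 :=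
      fun i => by split_ifs <;> simp
    simp only [this, Finset.sum_sub_distrib, hcard, Finset.sum_ite_eq', Finset.mem_univ, if_true]
    ring
  have hτb : ∀ i, |τ i - if i = i₀ then (0 : ℝ) else 4| ≤ ε := fun i => by
    split_ifs with hi
    · simpa [hi] using hτ0
    · exact hτ i hi
  have st1 : 4 * N - 4 - 1 / 10 ≤ ∑ i, τ i := by
    have : ∑ i : Fin N, ((if i = i₀ then (0 : ℝ) else 4) - ε) ≤ ∑ i, τ i :=
      Finset.sum_le_sum fun i _ => by linarith [(abs_le.1 (hτb i)).1]
    rw [Finset.sum_sub_distrib, hcard, hite] at this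
    linarith
  have st2 : ∑ i, τ i ≤ 4 * N - 4 + 1 / 10 := by
    have : ∑ i, τ i ≤ ∑ i : Fin N, ((if i = i₀ then (0 : ℝ) else 4) + ε) :=
      Finset.sum_le_sum fun i _ => by linarith [(abs_le.1 (hτb i)).2]
    rw [Finset.sum_add_distrib, hcard, hite] at this
    linarith
  have d1 : ∑ i, (l i - l i₀) * (τ i - m i)
      = ∑ i, l i * τ i - ∑ i, l i * m i - l i₀ * (∑ i, τ i - ∑ i, m i) := by
    rw [← Finset.sum_sub_distrib, ← Finset.sum_sub_distrib, Finset.mul_sum, ← Finset.sum_sub_distrib]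
    exact Finset.sum_congr rfl fun i _ => by ring
  have d2 : ∑ i, (l i - l i₀) * m i = ∑ i, l i * m i - l i₀ * ∑ i, m i := by
    rw [Finset.mul_sum, ← Finset.sum_sub_distrib]
    exact Finset.sum_congr rfl fun i _ => by ring
  set A := ∑ i, l i * m i
  set B := ∑ i, l i * τ i
  set sm := ∑ i, m i
  set st := ∑ i, τ i
  have hε1 : ε ≤ 1 / 20 := by nlinarith
  -- For `l i₀ ≥ 0` it is enough that `τ` has the larger sum. For `l i₀ < 0` the positivity of `∑ l
  -- i * m i` bounds `-l i₀` by a multiple of `t`, which absorbs the negative contribution.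
  rcases le_or_gt 0 (l i₀) with h0 | h0
  · have h1 : 0 ≤ l i₀ * (st - sm) := mul_nonneg h0 (by linarith)
    have h2 : 0 ≤ (3 - 2 * ε) * t := mul_nonneg (by linarith) ht0
    linarith
  · set k := -l i₀ with hk
    have hk0 : 0 < k := by linarith
    have h1 : k * (N - 1 / 10) ≤ (1 + ε) * t := by nlinarith
    have h2 : k * (st - sm) ≤ k * (3 * N - 38 / 10) := by
      refine mul_le_mul_of_nonneg_left ?_ hk0.le
      linarith
    have h3 : (3 - 5 * ε) * ((1 + ε) * t) ≤ (3 - 2 * ε) * t := by nlinarith [mul_nonneg (sq_nonneg ε) ht0]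
    have h4 : (3 - 5 * ε) * (k * (N - 1 / 10)) ≤ (3 - 5 * ε) * ((1 + ε) * t) :=
      mul_le_mul_of_nonneg_left h1 (by linarith)
    have h5 : k * (3 * N - 38 / 10) ≤ (3 - 5 * ε) * (k * (N - 1 / 10)) := by
      have : 3 * N - 38 / 10 ≤ (3 - 5 * ε) * (N - 1 / 10) := by nlinarith
      calc _ ≤ k * ((3 - 5 * ε) * (N - 1 / 10)) := mul_le_mul_of_nonneg_left this hk0.le
        _ = _ := by ring
    have h6 : l i₀ * (st - sm) = - (k * (st - sm)) := by rw [hk]; ring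
    linarith

theorem inner_regDeriv_self {N : ℕ} (y v : Euc N) (hv : ‖v‖ = 1) :
    inner ℝ v (regDeriv 0 y v) = ‖y‖⁻¹ - ‖y‖⁻¹ ^ 3 * inner ℝ y v ^ 2 := by
  rw [regDeriv_apply, inner_sub_right, real_inner_smul_right, real_inner_smul_right,
    real_inner_self_eq_norm_sq, hv, real_inner_comm v y, regNorm_zero]
  ring

theorem inner_regDeriv_comm {N : ℕ} (ε : ℝ) (y x z : Euc N) :
    inner ℝ (regDeriv ε y x) z = inner ℝ x (regDeriv ε y z) := by
  simp only [regDeriv_apply, inner_sub_left, inner_sub_right, real_inner_smul_left,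
    real_inner_smul_right]
  rw [real_inner_comm x y]
  ring

/-- At `r = 1`, `d = 0` the expression vanishes identically in `c`. It is used with `r = ‖b - a‖⁻¹`,
`c = ⟨b, v⟩` and `d = ⟨a, v⟩`. -/
theorem abs_sub_one_le_of_near_unit {r c d δ : ℝ} (hδ : δ ≤ 1 / 100)
    (hr1 : 1 - δ ≤ r) (hr2 : r ≤ 1 + 2 * δ) (hc : |c| ≤ 1) (hd : |d| ≤ δ) :
    |r - r ^ 3 * (c - d) ^ 2 + c ^ 2 - 1| ≤ 40 * δ := by
  have hδ0 : 0 ≤ δ := (abs_nonneg d).trans hd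
  have h1 : |r - 1| ≤ 2 * δ := abs_le.2 ⟨by linarith, by linarith⟩
  have hr : |r| ≤ 2 := abs_le.2 ⟨by linarith, by linarith⟩
  have h2 : |r ^ 3 - 1| ≤ 14 * δ := by
    have e : r ^ 3 - 1 = (r - 1) * (r ^ 2 + r + 1) := by ring
    rw [e, abs_mul]
    have : |r ^ 2 + r + 1| ≤ 7 := by
      rw [abs_le]; constructor <;> nlinarith [abs_le.1 hr]
    calc |r - 1| * |r ^ 2 + r + 1| ≤ (2 * δ) * 7 := by gcongr
      _ = 14 * δ := by ring
  have hcd : |c - d| ≤ 3 / 2 := (abs_sub _ _).trans (by linarith)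
  have h3 : |(c - d) ^ 2| ≤ 9 / 4 := by
    rw [abs_pow]
    calc |c - d| ^ 2 ≤ (3 / 2) ^ 2 := by gcongr
      _ = 9 / 4 := by norm_num
  have h4 : |(c - d) ^ 2 - c ^ 2| ≤ 3 * δ := by
    have e : (c - d) ^ 2 - c ^ 2 = d * (d - 2 * c) := by ring
    rw [e, abs_mul]
    have : |d - 2 * c| ≤ 3 := by
      refine (abs_sub _ _).trans ?_
      rw [abs_mul, abs_two]
      linarith
    calc |d| * |d - 2 * c| ≤ δ * 3 := by gcongr
      _ = 3 * δ := by ring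
  have e : r - r ^ 3 * (c - d) ^ 2 + c ^ 2 - 1
      = (r - 1) - (r ^ 3 - 1) * (c - d) ^ 2 - ((c - d) ^ 2 - c ^ 2) := by ring
  rw [e]
  have h5 : |(r ^ 3 - 1) * (c - d) ^ 2| ≤ 14 * δ * (9 / 4) := by
    rw [abs_mul]; gcongr
  refine (abs_sub _ _).trans ?_
  have := abs_sub (r - 1) ((r ^ 3 - 1) * (c - d) ^ 2)
  linarith

theorem abs_quad_near_unit_le {N : ℕ} {a b v : Euc N} {δ : ℝ} (hδ : δ ≤ 1 / 100) (hb : ‖b‖ = 1)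
    (hv : ‖v‖ = 1) (ha : ‖a‖ ≤ δ) :
    |‖b - a‖⁻¹ - ‖b - a‖⁻¹ ^ 3 * inner ℝ (b - a) v ^ 2 + inner ℝ b v ^ 2 - 1| ≤ 40 * δ := by
  have hδ0 : 0 ≤ δ := (norm_nonneg a).trans ha
  have h1 := norm_sub_norm_le b a
  have h2 := norm_sub_le b a
  rw [hb] at h1 h2
  have hs : 0 < ‖b - a‖ := by linarith
  rw [inner_sub_left]
  refine abs_sub_one_le_of_near_unit hδ ?_ ?_ ?_ ?_
  · rw [← one_div, le_div_iff₀ hs]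
    nlinarith
  · rw [← one_div, div_le_iff₀ hs]
    nlinarith
  · simpa [hb, hv] using abs_real_inner_le_norm b v
  · have := abs_real_inner_le_norm a v
    rw [hv, mul_one] at this
    exact this.trans ha

theorem norm_near_quarter {N : ℕ} {a e : Euc N} {δ : ℝ} (he : ‖e‖ = 1)
    (ha : ‖a - (1 / 4 : ℝ) • e‖ ≤ δ) : 1 / 4 - δ ≤ ‖a‖ ∧ ‖a‖ ≤ 1 / 4 + δ := by
  have h0 : ‖(1 / 4 : ℝ) • e‖ = 1 / 4 := by rw [norm_smul, he]; norm_num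
  have h1 := norm_sub_norm_le ((1 / 4 : ℝ) • e) a
  have h2 := norm_sub_norm_le a ((1 / 4 : ℝ) • e)
  rw [norm_sub_rev] at h1
  constructor <;> linarith

theorem inv_pow_three_le_of_near_quarter {s δ : ℝ} (hδ : δ ≤ 1 / 100) (hs : 1 / 4 - δ ≤ s) :
    s⁻¹ ^ 3 ≤ 512 := by
  have h1 : s⁻¹ ≤ 8 := by
    have := inv_anti₀ (by norm_num : (0 : ℝ) < 1 / 8) (by linarith : 1 / 8 ≤ s)
    norm_num at this ⊢
    exact this
  have h0 : 0 ≤ s⁻¹ := inv_nonneg.2 (by linarith)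
  calc s⁻¹ ^ 3 ≤ 8 ^ 3 := by gcongr
    _ = 512 := by norm_num

/-- At `e / 4` the derivative of `y / |y|` is `4` times the projection onto the complement of `e`.
This is its quadratic form in a direction orthogonal to `e`; `abs_quad_parallel_le` treats `e`
itself, where the form is near `0`. -/
theorem abs_quad_orthogonal_le {N : ℕ} {a e v : Euc N} {δ : ℝ} (hδ : δ ≤ 1 / 100) (he : ‖e‖ = 1)
    (hv : ‖v‖ = 1) (hev : inner ℝ e v = 0) (ha : ‖a - (1 / 4 : ℝ) • e‖ ≤ δ) :
    |‖a‖⁻¹ - ‖a‖⁻¹ ^ 3 * inner ℝ a v ^ 2 - 4| ≤ 600 * δ := by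
  have hδ0 : 0 ≤ δ := (norm_nonneg _).trans ha
  obtain ⟨h1, h2⟩ := norm_near_quarter he ha
  have hs : 0 < ‖a‖ := by linarith
  have h3 := inv_pow_three_le_of_near_quarter hδ h1
  have h4 : |inner ℝ a v| ≤ δ := by
    have e1 : inner ℝ a v = inner ℝ (a - (1 / 4 : ℝ) • e) v := by
      rw [inner_sub_left, real_inner_smul_left, hev]; ring
    have := abs_real_inner_le_norm (a - (1 / 4 : ℝ) • e) v
    rw [hv, mul_one] at this
    rw [e1]; exact this.trans ha
  have h5 : |‖a‖⁻¹ - 4| ≤ 32 * δ := by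
    have e1 : ‖a‖⁻¹ - 4 = (1 - 4 * ‖a‖) / ‖a‖ := by field_simp
    rw [e1, abs_div, abs_of_pos hs, div_le_iff₀ hs]
    have : |1 - 4 * ‖a‖| ≤ 4 * δ := abs_le.2 ⟨by linarith, by linarith⟩
    nlinarith
  have h6 : inner ℝ a v ^ 2 ≤ δ * δ := by
    rw [← sq_abs, sq]; gcongr
  have h7 : ‖a‖⁻¹ ^ 3 * inner ℝ a v ^ 2 ≤ 512 * (δ * δ) := by gcongr
  have h8 : 0 ≤ ‖a‖⁻¹ ^ 3 * inner ℝ a v ^ 2 := by positivity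
  have := abs_le.1 h5
  rw [abs_le]
  constructor <;> nlinarith

theorem abs_quad_parallel_le {N : ℕ} {a e : Euc N} {δ : ℝ} (hδ : δ ≤ 1 / 100) (he : ‖e‖ = 1)
    (ha : ‖a - (1 / 4 : ℝ) • e‖ ≤ δ) :
    |‖a‖⁻¹ - ‖a‖⁻¹ ^ 3 * inner ℝ a e ^ 2| ≤ 600 * δ := by
  have hδ0 : 0 ≤ δ := (norm_nonneg _).trans ha
  obtain ⟨h1, h2⟩ := norm_near_quarter he ha
  have hs : 0 < ‖a‖ := by linarith
  have h3 := inv_pow_three_le_of_near_quarter hδ h1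
  have h4 : 1 / 4 - δ ≤ inner ℝ a e := by
    have e1 : inner ℝ a e = 1 / 4 + inner ℝ (a - (1 / 4 : ℝ) • e) e := by
      rw [inner_sub_left, real_inner_smul_left, real_inner_self_eq_norm_sq, he]; ring
    have := neg_le_of_abs_le (abs_real_inner_le_norm (a - (1 / 4 : ℝ) • e) e)
    rw [he, mul_one] at this
    linarith
  have h5 : inner ℝ a e ≤ ‖a‖ := by simpa [he] using real_inner_le_norm a e
  have e1 : ‖a‖⁻¹ - ‖a‖⁻¹ ^ 3 * inner ℝ a e ^ 2
      = ‖a‖⁻¹ ^ 3 * (‖a‖ ^ 2 - inner ℝ a e ^ 2) := by field_simp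
  have h6 : 0 ≤ ‖a‖ ^ 2 - inner ℝ a e ^ 2 := by nlinarith
  have h7 : ‖a‖ ^ 2 - inner ℝ a e ^ 2 ≤ δ := by nlinarith
  rw [e1, abs_of_nonneg (by positivity)]
  calc _ ≤ 512 * δ := by gcongr
    _ ≤ 600 * δ := by linarith

/-- If `f` is convex and its averages over the radial projections of a linear map are controlled,
then so are its values at projections of tangential gradients from centres near the origin. -/
theorem exists_pointwise_bound_of_average {n N : ℕ} (hN : 2 ≤ N) :
    ∃ δ : ℝ, 0 < δ ∧ δ ≤ 1 / 4 ∧ ∃ κ : ℝ, 0 ≤ κ ∧ ∀ g : EucMat N n → ℝ, ContDiff ℝ 1 g →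
      (∀ ξ η, 0 ≤ inner ℝ (gradient g ξ - gradient g η) (ξ - η)) → (∀ ξ, 0 ≤ g ξ) →
      ∀ (ζ : EucMat N n) (A : ℝ), 0 ≤ A →
        ∫⁻ a in Metric.ball (0 : Euc N) (1 / 2), ENNReal.ofReal (g (radGrad (0 - a) ζ))
          ≤ ENNReal.ofReal A →
        ∀ b : Euc N, ‖b‖ = 1 → (∀ k, inner ℝ b (matCol ζ k) = 0) →
          ∀ a : Euc N, ‖a‖ ≤ δ → g (radGrad (b - a) ζ) ≤ g 0 + κ * A := by
  have hN' : (2 : ℝ) ≤ N := by exact_mod_cast hN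
  -- The quadratic forms are known up to `600 δ`, and `600 δ N` must not exceed the tolerance `1 /
  -- 10` of `sum_mul_le_sum_mul_of_close`.
  set δ : ℝ := 1 / (6000 * N) with hδ
  have hδ0 : 0 < δ := by positivity
  have hδN : 600 * δ * N = 1 / 10 := by rw [hδ]; field_simp; norm_num
  have hδ1 : δ ≤ 1 / 100 := by nlinarith
  set V : ℝ≥0∞ := volume (Metric.ball (0 : Euc N) δ) with hV
  have hV0 : 0 < V.toReal := ENNReal.toReal_pos (Metric.measure_ball_pos _ _ hδ0).ne'
    measure_ball_lt_top.ne
  refine ⟨δ, hδ0, by linarith, V.toReal⁻¹, by positivity, ?_⟩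
  intro g hg hmono hg0 ζ A hA hint b hb hbζ a ha
  set η := radGrad (b - a) ζ with hη
  set Q := gradient g η with hQ
  have hconv := add_inner_gradient_le_of_monotone (hg.differentiable one_ne_zero) hmono η
  have hκA : 0 ≤ V.toReal⁻¹ * A := by positivity
  -- If `⟨Q, η⟩ ≤ 0`, the supporting hyperplane at `η`, evaluated at `0`, already gives `g η ≤ g 0`.
  rcases le_or_gt (inner ℝ Q η) 0 with hQη | hQη
  · have h1 := hconv 0
    rw [zero_sub, inner_neg_right] at h1
    linarith
  obtain ⟨v, l, hvl⟩ := exists_orthonormalBasis_inner_matMap Q ζ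
  have hvn : ∀ i, ‖v i‖ = 1 := fun i => v.orthonormal.1 i
  -- The columns of `ζ` are orthogonal to `b`, so adding the projection onto `b` does not change the
  -- product with `ζ`, while it turns the degenerate derivative into a symmetric map close to the
  -- identity.
  set M : Euc N →L[ℝ] Euc N := regDeriv 0 (b - a) + (innerSL ℝ b).smulRight b with hM
  have hMζ : matMap M ζ = η := by
    ext z
    simp [hM, hη, radGrad, hbζ]
  have hMs : ∀ x y, inner ℝ (M x) y = inner ℝ x (M y) := by
    intro x y
    simp only [hM, add_apply, inner_add_left, inner_add_right,
      inner_regDeriv_comm, ContinuousLinearMap.smulRight_apply, innerSL_apply_apply,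
      real_inner_smul_left, real_inner_smul_right]
    rw [real_inner_comm x b]; ring
  have hQM : inner ℝ Q η = ∑ i, l i * inner ℝ (v i) (M (v i)) := by
    rw [← hMζ]; exact hvl M hMs
  have hne : Nonempty (Fin N) := ⟨⟨0, by omega⟩⟩
  obtain ⟨i₀, hi₀⟩ := Finite.exists_min l
  have hm : ∀ i, |inner ℝ (v i) (M (v i)) - 1| ≤ 600 * δ := by
    intro i
    have h1 := abs_quad_near_unit_le hδ1 hb (hvn i) ha
    have h2 : inner ℝ (v i) (M (v i)) = ‖b - a‖⁻¹ - ‖b - a‖⁻¹ ^ 3 * inner ℝ (b - a) (v i) ^ 2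
        + inner ℝ b (v i) ^ 2 := by
      simp only [hM, add_apply, inner_add_right, inner_regDeriv_self _ _ (hvn i),
        ContinuousLinearMap.smulRight_apply, innerSL_apply_apply, real_inner_smul_right]
      rw [real_inner_comm (v i) b]; ring
    rw [h2]
    linarith
  -- Centres near a quarter of the eigenvector of the smallest weight: projecting from there removes
  -- the least favourable direction and multiplies the others by about `4`, so `⟨Q, ·⟩` does not
  -- decrease and convexity gives `g η ≤ g` there.
  have hball : ∀ a' ∈ Metric.ball ((1 / 4 : ℝ) • v i₀) δ, g η ≤ g (radGrad (0 - a') ζ) := by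
    intro a' ha'
    have ha'' : ‖a' - (1 / 4 : ℝ) • v i₀‖ ≤ δ := by
      rw [← dist_eq_norm]; exact (Metric.mem_ball.1 ha').le
    have hq : ∀ i, inner ℝ (v i) (regDeriv 0 (0 - a') (v i))
        = ‖a'‖⁻¹ - ‖a'‖⁻¹ ^ 3 * inner ℝ a' (v i) ^ 2 := fun i => by
      rw [inner_regDeriv_self _ _ (hvn i), zero_sub, norm_neg, inner_neg_left, neg_sq]
    have h1 := sum_mul_le_sum_mul_of_close hN (by positivity) hδN.le hi₀ hm
      (τ := fun i => inner ℝ (v i) (regDeriv 0 (0 - a') (v i)))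
      (fun i hi => by
        rw [hq]
        exact abs_quad_orthogonal_le hδ1 (hvn i₀) (hvn i) (v.orthonormal.2 (Ne.symm hi)) ha'')
      (by
        simp only [hq]
        exact abs_quad_parallel_le hδ1 (hvn i₀) ha'')
      (by rw [← hQM]; exact hQη)
    rw [← hQM, ← hvl _ (inner_regDeriv_comm 0 (0 - a'))] at h1
    have h2 := hconv (radGrad (0 - a') ζ)
    have h3 : inner ℝ Q (radGrad (0 - a') ζ - η) = inner ℝ Q (matMap (regDeriv 0 (0 - a')) ζ)
      - inner ℝ Q η := inner_sub_right _ _ _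
    rw [h3] at h2
    linarith
  have hsub : Metric.ball ((1 / 4 : ℝ) • v i₀) δ ⊆ Metric.ball (0 : Euc N) (1 / 2) := by
    refine Metric.ball_subset_ball' ?_
    rw [dist_zero_right, norm_smul, hvn]
    norm_num
    linarith
  have h1 : ENNReal.ofReal (g η) * V ≤ ENNReal.ofReal A := by
    refine le_trans ?_ hint
    calc ENNReal.ofReal (g η) * V
        = ∫⁻ _a' in Metric.ball ((1 / 4 : ℝ) • v i₀) δ, ENNReal.ofReal (g η) := by
          rw [setLIntegral_const, hV, Measure.addHaar_ball_center volume ((1 / 4 : ℝ) • v i₀)]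
      _ ≤ ∫⁻ a' in Metric.ball ((1 / 4 : ℝ) • v i₀) δ, ENNReal.ofReal (g (radGrad (0 - a') ζ)) :=
          setLIntegral_mono' measurableSet_ball fun a' ha' =>
            ENNReal.ofReal_le_ofReal (hball a' ha')
      _ ≤ _ := lintegral_mono_set hsub
  have h2 := ENNReal.toReal_mono ENNReal.ofReal_ne_top h1
  rw [ENNReal.toReal_mul, ENNReal.toReal_ofReal (hg0 η), ENNReal.toReal_ofReal hA] at h2
  have h3 : g η ≤ V.toReal⁻¹ * A := by
    rw [inv_mul_eq_div, le_div_iff₀ hV0]; exact h2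
  linarith [hg0 0]

/-! ### Uniqueness and tangentiality of weak gradients, measurable representatives -/

theorem integrable_mul_coord_of_locallyIntegrableOn {n : ℕ} {ι : Type*} [Fintype ι]
    {U : Set (Euc n)} {D : Euc n → EuclideanSpace ℝ ι} (hD : LocallyIntegrableOn D U volume)
    {φ : Euc n → ℝ} (hφ : Continuous φ) (hφc : HasCompactSupport φ) (hφU : tsupport φ ⊆ U)
    (i : ι) : Integrable (fun x => φ x * D x i) volume := by
  have h1 : IntegrableOn D (tsupport φ) volume := hD.integrableOn_compact_subset hφU hφc
  have h2 : IntegrableOn (fun x => D x i) (tsupport φ) volume :=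
    (EuclideanSpace.proj i : EuclideanSpace ℝ ι →L[ℝ] ℝ).integrable_comp h1
  have h3 : IntegrableOn (fun x => φ x * D x i) (tsupport φ) volume :=
    h2.continuousOn_mul hφ.continuousOn hφc
  refine (integrableOn_iff_integrable_of_support_subset ?_).1 h3
  intro x hx
  by_contra h
  exact hx (by simp [image_eq_zero_of_notMem_tsupport h])

/-- Uniqueness of weak gradients. -/
theorem HasWeakGrad.ae_eq {n N : ℕ} {U : Set (Euc n)} (hU : IsOpen U) {v w : Euc n → Euc N}
    {Dv Dw : Euc n → EucMat N n} (hv : HasWeakGrad U v Dv) (hw : HasWeakGrad U w Dw)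
    (hvw : v =ᵐ[volume.restrict U] w) : Dv =ᵐ[volume.restrict U] Dw := by
  have key : ∀ z : Fin N × Fin n, ∀ᵐ x ∂volume, x ∈ U → Dv x z - Dw x z = 0 := by
    rintro ⟨i, k⟩
    have hp : ∀ {D : Euc n → EucMat N n}, LocallyIntegrableOn D U volume →
        LocallyIntegrableOn (fun x => D x (i, k)) U volume := fun hD => by
      refine LocallyIntegrableOn.mono_restrict hD
        ((EuclideanSpace.proj (i, k) : EucMat N n →L[ℝ] ℝ).continuous.comp_aestronglyMeasurable
          hD.aestronglyMeasurable) (Eventually.of_forall fun x => norm_apply_le_norm _ _)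
    refine hU.ae_eq_zero_of_integral_contDiff_smul_eq_zero ((hp hv.2.1).sub (hp hw.2.1))
      fun φ hφ hφc hφU => ?_
    have i1 := integrable_mul_coord_of_locallyIntegrableOn hv.2.1 hφ.continuous hφc hφU (i, k)
    have i2 := integrable_mul_coord_of_locallyIntegrableOn hw.2.1 hφ.continuous hφc hφU (i, k)
    have e1 := hv.2.2 φ hφ hφc hφU i k
    have e2 := hw.2.2 φ hφ hφc hφU i k
    have e3 : ∫ x in U, fderiv ℝ φ x (EuclideanSpace.single k 1) * v x i
        = ∫ x in U, fderiv ℝ φ x (EuclideanSpace.single k 1) * w x i := by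
      refine integral_congr_ae ?_
      filter_upwards [hvw] with x hx
      rw [hx]
    rw [e1, e2, neg_inj,
      setIntegral_eq_integral_of_tsupport_subset hφU
        (fun y hy => by simp [image_eq_zero_of_notMem_tsupport hy]),
      setIntegral_eq_integral_of_tsupport_subset hφU
        (fun y hy => by simp [image_eq_zero_of_notMem_tsupport hy])] at e3
    simp only [smul_eq_mul, mul_sub]
    rw [integral_sub i1 i2, e3, sub_self]
  refine (ae_restrict_iff' hU.measurableSet).2 ?_
  filter_upwards [ae_all_iff.2 key] with x hx hxU
  ext z
  exact sub_eq_zero.1 (hx z hxU)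

/-- The gradient of a sphere-valued map is tangential. -/
theorem HasWeakGrad.inner_matCol_eq_zero {n N : ℕ} {U : Set (Euc n)} (hU : IsOpen U)
    {u : Euc n → Euc N} {Du : Euc n → EucMat N n} (h : HasWeakGrad U u Du)
    (hu : ∀ᵐ x ∂volume.restrict U, ‖u x‖ = 1) :
    ∀ᵐ x ∂volume.restrict U, ∀ k, inner ℝ (u x) (matCol (Du x) k) = 0 := by
  -- On the unit sphere `y / √(|y|² + 1)` agrees with `y / √2`. Both chain rules apply to `u`, and
  -- uniqueness of the weak gradient leaves `c³ ⟨u, ∂ₖu⟩ u = 0`.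
  set c : ℝ := (√2)⁻¹ with hc
  have hc0 : c ≠ 0 := by positivity
  have hnorm : ∀ y : Euc N, ‖y‖ = 1 → (regNorm 1 y)⁻¹ = c := fun y hy => by
    rw [hc, regNorm, hy]; norm_num
  have h1 := h.regProj_sub hU one_ne_zero 0
  have hd : ∀ y : Euc N, HasFDerivAt (fun y : Euc N => c • y)
      (c • ContinuousLinearMap.id ℝ (Euc N)) y := fun y => (hasFDerivAt_id y).const_smul c
  have h2 := h.comp_of_fderiv_le hU (Ψ := fun y => c • y) (contDiff_id.const_smul c)
    (L := ‖c • ContinuousLinearMap.id ℝ (Euc N)‖) (fun y => by rw [(hd y).fderiv])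
  have h3 := HasWeakGrad.ae_eq hU h1 h2 (by
    filter_upwards [hu] with x hx
    rw [sub_zero, regProj, hnorm _ hx])
  filter_upwards [h3, hu] with x hx hux k
  have h4 := congrArg (fun ζ => matCol ζ k) hx
  simp only [matCol_matMap, sub_zero, regDeriv_apply, hnorm _ hux, (hd _).fderiv] at h4
  have h5 : (c ^ 3 * inner ℝ (u x) (matCol (Du x) k)) • u x = 0 := by
    simpa using h4
  have hne : u x ≠ 0 := fun h => by simp [h] at hux
  rcases smul_eq_zero.1 h5 with h6 | h6
  · exact (mul_eq_zero.1 h6).resolve_left (pow_ne_zero 3 hc0)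
  · exact absurd h6 hne

/-- A Carathéodory function agrees almost everywhere with a jointly measurable one. -/
theorem IsCaratheodory.exists_measurable {n N : ℕ} {Ω : Set (Euc n)} {f : Euc n → EucMat N n → ℝ}
    (hf : IsCaratheodory Ω f) (hΩ : MeasurableSet Ω) :
    ∃ g : Euc n × EucMat N n → ℝ, Measurable g ∧
      ∀ᵐ x ∂volume.restrict Ω, ∀ ζ, f x ζ = g (x, ζ) := by
  set d := TopologicalSpace.denseSeq (EucMat N n)
  have hae : ∀ᵐ x ∂volume.restrict Ω, x ∈ Ω ∧ ∀ j, f x (d j) = (hf.1 (d j)).mk _ x :=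
    (ae_restrict_mem hΩ).and (ae_all_iff.2 fun j => (hf.1 (d j)).ae_eq_mk)
  obtain ⟨s, hs, hsm, hsP⟩ := hae.exists_measurable_mem
  -- Replacing the function by `0` off a measurable set `s` of full measure gives continuity in `ζ`
  -- for every `x`. Measurability in `x` then passes from the dense sequence to all `ζ`.
  set u : EucMat N n → Euc n → ℝ := fun ζ => s.indicator fun x => f x ζ with hu
  have hcont : ∀ x, Continuous fun ζ => u ζ x := fun x => by
    by_cases hx : x ∈ s
    · simpa [hu, Set.indicator_of_mem hx] using hf.2 x (hsP x hx).1
    · simpa [hu, Set.indicator_of_notMem hx] using continuous_const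
  have hdm : ∀ j, Measurable (u (d j)) := fun j => by
    have : u (d j) = s.indicator ((hf.1 (d j)).mk _) := by
      funext x
      by_cases hx : x ∈ s
      · simp [hu, Set.indicator_of_mem hx, (hsP x hx).2 j]
      · simp [hu, Set.indicator_of_notMem hx]
    rw [this]
    exact (hf.1 (d j)).stronglyMeasurable_mk.measurable.indicator hsm
  have hm : ∀ ζ, StronglyMeasurable (u ζ) := fun ζ => by
    have hmem : ζ ∈ closure (Set.range d) := by
      rw [(TopologicalSpace.denseRange_denseSeq _).closure_range]; trivial
    obtain ⟨y, hy, hylim⟩ := mem_closure_iff_seq_limit.1 hmem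
    choose k hk using hy
    refine (measurable_of_tendsto_metrizable (f := fun j => u (d (k j))) (fun j => hdm _) ?_).stronglyMeasurable
    refine tendsto_pi_nhds.2 fun x => ?_
    have : Tendsto (fun j => d (k j)) atTop (𝓝 ζ) := by simpa only [hk] using hylim
    exact ((hcont x).tendsto ζ).comp this
  refine ⟨fun z => u z.2 z.1, ((stronglyMeasurable_uncurry_of_continuous_of_stronglyMeasurable
    hcont hm).measurable.comp measurable_swap), ?_⟩
  filter_upwards [hs] with x hx ζ
  simp [hu, Set.indicator_of_mem hx]

theorem HasWeakGrad.congr_ae {n N : ℕ} {U : Set (Euc n)} {v w : Euc n → Euc N}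
    {Dv Dw : Euc n → EucMat N n} (h : HasWeakGrad U v Dv) (hv : v =ᵐ[volume.restrict U] w)
    (hD : Dv =ᵐ[volume.restrict U] Dw) : HasWeakGrad U w Dw := by
  refine ⟨LocallyIntegrableOn.mono_restrict h.1 (h.1.aestronglyMeasurable.congr hv)
      (by filter_upwards [hv] with x hx; rw [hx]),
    LocallyIntegrableOn.mono_restrict h.2.1 (h.2.1.aestronglyMeasurable.congr hD)
      (by filter_upwards [hD] with x hx; rw [hx]), fun φ hφ hφc hφU i k => ?_⟩
  refine Eq.trans (integral_congr_ae ?_) ((h.2.2 φ hφ hφc hφU i k).trans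
    (congrArg Neg.neg (integral_congr_ae ?_)))
  · filter_upwards [hv] with x hx; rw [hx]
  · filter_upwards [hD] with x hx; rw [hx]

theorem MemW1p.exists_measurable {n N : ℕ} {p : ℝ} {U : Set (Euc n)} {u : Euc n → Euc N}
    {Du : Euc n → EucMat N n} (h : MemW1p p U u Du) :
    ∃ (v : Euc n → Euc N) (Dv : Euc n → EucMat N n), Measurable v ∧ Measurable Dv ∧
      u =ᵐ[volume.restrict U] v ∧ Du =ᵐ[volume.restrict U] Dv ∧ MemW1p p U v Dv := by
  have e1 := h.1.1.ae_eq_mk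
  have e2 := h.2.1.1.ae_eq_mk
  exact ⟨_, _, h.1.1.stronglyMeasurable_mk.measurable, h.2.1.1.stronglyMeasurable_mk.measurable,
    e1, e2, (memLp_congr_ae e1).1 h.1, (memLp_congr_ae e2).1 h.2.1, h.2.2.congr_ae e1 e2⟩

/-! ### The deviation and the choice of a centre -/

theorem add_rpow_le_two_rpow_mul {a b p : ℝ} (ha : 0 ≤ a) (hb : 0 ≤ b) (hp : 0 ≤ p) :
    (a + b) ^ p ≤ 2 ^ p * (a ^ p + b ^ p) := by
  have h1 : (a + b) ^ p ≤ (2 * max a b) ^ p := by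
    refine Real.rpow_le_rpow (by positivity) ?_ hp
    linarith [le_max_left a b, le_max_right a b]
  refine h1.trans ?_
  rw [Real.mul_rpow (by norm_num) (le_max_of_le_left ha)]
  gcongr
  rcases max_choice a b with h | h <;> rw [h]
  · linarith [Real.rpow_nonneg hb p]
  · linarith [Real.rpow_nonneg ha p]

theorem measurable_regProj_zero {N : ℕ} : Measurable (regProj (N := N) 0) := by
  have h0 : Measurable fun y : Euc N => (regNorm 0 y)⁻¹ := by unfold regNorm; fun_prop
  exact h0.smul measurable_id

/-- The deviation of a value `w` and a gradient `ζ` from `u x` and `Du x`. -/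
noncomputable def deviation {α : Type*} {n N : ℕ} (p : ℝ) (g : α × EucMat N n → ℝ)
    (u : α → Euc N) (Du : α → EucMat N n) (x : α) (w : Euc N) (ζ : EucMat N n) : ℝ :=
  ‖w - u x‖ ^ p + ‖ζ - Du x‖ ^ p + |g (x, ζ) - g (x, Du x)|

/-- The deviation of the radial projection with centre `a` of a map with value `b` and gradient
`ζ` at `x`. -/
noncomputable def projDeviation {α : Type*} {n N : ℕ} (p : ℝ) (g : α × EucMat N n → ℝ)
    (u : α → Euc N) (Du : α → EucMat N n) (x : α) (b : Euc N) (ζ : EucMat N n) (a : Euc N) :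
    ℝ≥0∞ :=
  ENNReal.ofReal (deviation p g u Du x (regProj 0 (b - a)) (radGrad (b - a) ζ))

section

variable {α : Type*} {n N : ℕ} {p : ℝ} {g : α × EucMat N n → ℝ}
  {u : α → Euc N} {Du : α → EucMat N n}

theorem deviation_le (hp : 0 ≤ p) {x : α} (hlow : ∀ ζ, ‖ζ‖ ^ p ≤ g (x, ζ)) (hux : ‖u x‖ = 1)
    {w : Euc N} (hw : ‖w‖ ≤ 1) (ζ : EucMat N n) :
    deviation p g u Du x w ζ ≤ (2 ^ p + 1) * (1 + g (x, ζ) + g (x, Du x)) := by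
  have h2 : (0 : ℝ) ≤ 2 ^ p := by positivity
  have h0 : ∀ ζ, 0 ≤ g (x, ζ) := fun ζ => (Real.rpow_nonneg (norm_nonneg ζ) p).trans (hlow ζ)
  have a1 : ‖w - u x‖ ^ p ≤ 2 ^ p := by
    refine Real.rpow_le_rpow (norm_nonneg _) ((norm_sub_le _ _).trans ?_) hp
    linarith
  have a2 : ‖ζ - Du x‖ ^ p ≤ 2 ^ p * (g (x, ζ) + g (x, Du x)) := by
    refine (Real.rpow_le_rpow (norm_nonneg _) (norm_sub_le _ _) hp).trans ?_
    refine (add_rpow_le_two_rpow_mul (norm_nonneg _) (norm_nonneg _) hp).trans ?_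
    gcongr <;> exact hlow _
  have a3 : |g (x, ζ) - g (x, Du x)| ≤ g (x, ζ) + g (x, Du x) :=
    abs_le.2 ⟨by linarith [h0 ζ, h0 (Du x)], by linarith [h0 ζ, h0 (Du x)]⟩
  unfold deviation
  nlinarith [h0 ζ, h0 (Du x)]

theorem tendsto_projDeviation {ι : Type*} {l : Filter ι} (hp : 0 < p) {x : α}
    (hcont : Continuous fun ζ => g (x, ζ)) {b : ι → Euc N} {ζ : ι → EucMat N n} {a : ι → Euc N}
    {b' : Euc N} {ζ' : EucMat N n} {a' : Euc N} (hb : Tendsto b l (𝓝 b'))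
    (hζ : Tendsto ζ l (𝓝 ζ')) (ha : Tendsto a l (𝓝 a')) (hne : b' ≠ a') :
    Tendsto (fun i => projDeviation p g u Du x (b i) (ζ i) (a i)) l
      (𝓝 (projDeviation p g u Du x b' ζ' a')) := by
  have hs := hb.sub ha
  have hne' := sub_ne_zero.2 hne
  have h1 := tendsto_regProj (tendsto_const_nhds (x := (0 : ℝ))) hs hne'
  have h2 := tendsto_radGrad hs hζ hne'
  have h3 := (hcont.tendsto (radGrad (b' - a') ζ')).comp h2
  refine (ENNReal.continuous_ofReal.tendsto _).comp ?_
  exact (((h1.sub_const _).norm.rpow_const (Or.inr hp.le)).add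
    ((h2.sub_const _).norm.rpow_const (Or.inr hp.le))).add (h3.sub_const _).abs

/-- Provides the majorant for generalized dominated convergence: a fixed multiple of `1 + f(x, Du)`,
plus an error that vanishes in `L¹` along the given sequence. -/
theorem lintegral_projDeviation_le (hp : 0 ≤ p) {x : α} (hlow : ∀ ζ, ‖ζ‖ ^ p ≤ g (x, ζ))
    (hux : ‖u x‖ = 1) {K ρ : ℝ} (hK : 0 ≤ K) (hρ : ρ ≤ 1 / 2)
    (hcont : Continuous fun ζ => g (x, ζ))
    (havg : ∀ (b : Euc N) (ζ : EucMat N n),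
      ∫⁻ a in Metric.ball (0 : Euc N) (1 / 2), ENNReal.ofReal (g (x, radGrad (b - a) ζ))
        ≤ ENNReal.ofReal (K * (g (x, ζ) + 1)))
    (b : Euc N) (ζ : EucMat N n) :
    ∫⁻ a in Metric.ball (0 : Euc N) ρ, projDeviation p g u Du x b ζ a
      ≤ (ENNReal.ofReal (2 ^ p + 1) * volume (Metric.ball (0 : Euc N) ρ)
          + ENNReal.ofReal ((2 ^ p + 1) * K)) * ENNReal.ofReal (1 + g (x, Du x))
        + ENNReal.ofReal ((2 ^ p + 1) * K) * ‖g (x, ζ) - g (x, Du x)‖ₑ := by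
  have h0 : ∀ ζ, 0 ≤ g (x, ζ) := fun ζ => (Real.rpow_nonneg (norm_nonneg ζ) p).trans (hlow ζ)
  have hc0 : (0 : ℝ) ≤ 2 ^ p + 1 := by positivity
  have hm : Measurable fun a => ENNReal.ofReal (g (x, radGrad (b - a) ζ)) :=
    (hcont.measurable.comp (measurable_radGrad (measurable_id.const_sub b)
      measurable_const)).ennreal_ofReal
  have h1 : ∀ a, projDeviation p g u Du x b ζ a ≤ ENNReal.ofReal (2 ^ p + 1) *
      (ENNReal.ofReal (1 + g (x, Du x)) + ENNReal.ofReal (g (x, radGrad (b - a) ζ))) := by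
    intro a
    rw [← ENNReal.ofReal_add (by linarith [h0 (Du x)]) (h0 _), ← ENNReal.ofReal_mul hc0]
    refine ENNReal.ofReal_le_ofReal ((deviation_le hp hlow hux (norm_regProj_le _ _) _).trans_eq ?_)
    ring
  have h2 : ENNReal.ofReal (K * (g (x, ζ) + 1))
      ≤ ENNReal.ofReal K * (ENNReal.ofReal (1 + g (x, Du x)) + ‖g (x, ζ) - g (x, Du x)‖ₑ) := by
    rw [← ofReal_norm, ← ENNReal.ofReal_add (by linarith [h0 (Du x)]) (norm_nonneg _),
      ← ENNReal.ofReal_mul hK]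
    refine ENNReal.ofReal_le_ofReal (mul_le_mul_of_nonneg_left ?_ hK)
    have := le_abs_self (g (x, ζ) - g (x, Du x))
    rw [Real.norm_eq_abs]
    linarith
  calc ∫⁻ a in Metric.ball (0 : Euc N) ρ, projDeviation p g u Du x b ζ a
      ≤ ∫⁻ a in Metric.ball (0 : Euc N) ρ, ENNReal.ofReal (2 ^ p + 1) *
      (ENNReal.ofReal (1 + g (x, Du x)) + ENNReal.ofReal (g (x, radGrad (b - a) ζ))) :=
        lintegral_mono h1
    _ = ENNReal.ofReal (2 ^ p + 1) * (ENNReal.ofReal (1 + g (x, Du x))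
          * volume (Metric.ball (0 : Euc N) ρ)
          + ∫⁻ a in Metric.ball (0 : Euc N) ρ, ENNReal.ofReal (g (x, radGrad (b - a) ζ))) := by
        have hm' : Measurable fun a => ENNReal.ofReal (1 + g (x, Du x))
            + ENNReal.ofReal (g (x, radGrad (b - a) ζ)) := measurable_const.add hm
        rw [lintegral_const_mul _ hm', lintegral_add_left measurable_const,
          setLIntegral_const]
    _ ≤ ENNReal.ofReal (2 ^ p + 1) * (ENNReal.ofReal (1 + g (x, Du x))
          * volume (Metric.ball (0 : Euc N) ρ)
          + ENNReal.ofReal K * (ENNReal.ofReal (1 + g (x, Du x))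
            + ‖g (x, ζ) - g (x, Du x)‖ₑ)) := by
        gcongr
        exact (lintegral_mono_set (Metric.ball_subset_ball hρ)).trans ((havg b ζ).trans h2)
    _ = _ := by
        rw [ENNReal.ofReal_mul hc0]; ring

/-- Centres within `1/4` of the origin stay at distance at least `1/2` from values within `1/4` of
the unit vector `u x`. Projected gradients then remain in a fixed compact set, where the integrand
is bounded. -/
theorem tendsto_lintegral_projDeviation (hp : 0 < p) {x : α} (hlow : ∀ ζ, ‖ζ‖ ^ p ≤ g (x, ζ))
    (hux : ‖u x‖ = 1) (hcont : Continuous fun ζ => g (x, ζ)) {ρ : ℝ} (hρ : ρ ≤ 1 / 4)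
    {b : ℕ → Euc N} {ζ : ℕ → EucMat N n} (hb : Tendsto b atTop (𝓝 (u x)))
    (hζ : Tendsto ζ atTop (𝓝 (Du x))) :
    Tendsto (fun j => ∫⁻ a in Metric.ball (0 : Euc N) ρ, projDeviation p g u Du x (b j) (ζ j) a)
      atTop (𝓝 (∫⁻ a in Metric.ball (0 : Euc N) ρ, projDeviation p g u Du x (u x) (Du x) a)) := by
  have h0 : ∀ ζ, 0 ≤ g (x, ζ) := fun ζ => (Real.rpow_nonneg (norm_nonneg ζ) p).trans (hlow ζ)
  obtain ⟨c, hc⟩ := (isCompact_closedBall (0 : EucMat N n)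
    (4 * (‖Du x‖ + 1))).exists_bound_of_continuousOn hcont.continuousOn
  have hballx : ∀ᵐ a ∂volume.restrict (Metric.ball (0 : Euc N) ρ), ‖a‖ < 1 / 4 := by
    filter_upwards [ae_restrict_mem measurableSet_ball] with a ha
    rw [mem_ball_zero_iff] at ha
    linarith
  refine tendsto_lintegral_filter_of_dominated_convergence
    (fun _ => ENNReal.ofReal ((2 ^ p + 1) * (1 + c + g (x, Du x)))) ?_ ?_ ?_ ?_
  · refine Eventually.of_forall fun j => ?_
    unfold projDeviation deviation
    have h1 : Measurable fun a => regProj 0 (b j - a) :=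
      measurable_regProj_zero.comp (measurable_id.const_sub (b j))
    have h2 : Measurable fun a => radGrad (b j - a) (ζ j) :=
      measurable_radGrad (measurable_id.const_sub (b j)) measurable_const
    exact ((((h1.sub_const (u x)).norm.pow_const p).add
      ((h2.sub_const (Du x)).norm.pow_const p)).add
      ((hcont.measurable.comp h2).sub_const (g (x, Du x))).norm).ennreal_ofReal
  · have e1 : ∀ᶠ j in atTop, ‖b j - u x‖ < 1 / 4 := by
      have := (hb.sub_const (u x)).norm
      rw [sub_self, norm_zero] at this
      exact this.eventually_lt_const (by norm_num)
    have e2 : ∀ᶠ j in atTop, ‖ζ j‖ < ‖Du x‖ + 1 := hζ.norm.eventually_lt_const (by linarith)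
    filter_upwards [e1, e2] with j h1 h2
    filter_upwards [hballx] with a ha
    refine ENNReal.ofReal_le_ofReal ((deviation_le hp.le hlow hux (norm_regProj_le _ _) _).trans ?_)
    have h3 : 1 / 2 ≤ ‖b j - a‖ := by
      have := norm_sub_norm_le (u x) (u x - (b j - a))
      rw [sub_sub_cancel, hux] at this
      have h4 : ‖u x - (b j - a)‖ ≤ ‖b j - u x‖ + ‖a‖ := by
        have : u x - (b j - a) = -(b j - u x) + a := by abel
        rw [this]
        exact (norm_add_le _ _).trans_eq (by rw [norm_neg])
      linarith
    have h5 : ‖radGrad (b j - a) (ζ j)‖ ≤ 4 * (‖Du x‖ + 1) := by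
      refine (norm_radGrad_le _ _).trans ?_
      have h6 : ‖b j - a‖⁻¹ ≤ 2 := by
        have := inv_anti₀ (by norm_num) h3
        norm_num at this
        exact this
      calc 2 * ‖b j - a‖⁻¹ * ‖ζ j‖ ≤ 2 * 2 * (‖Du x‖ + 1) := by gcongr
        _ = _ := by ring
    have h7 := hc _ (mem_closedBall_zero_iff.2 h5)
    have h8 := (le_abs_self _).trans h7
    gcongr
  · rw [setLIntegral_const]
    exact ENNReal.mul_ne_top ENNReal.ofReal_ne_top measure_ball_lt_top.ne
  · filter_upwards [hballx] with a ha
    refine tendsto_projDeviation hp hcont hb hζ tendsto_const_nhds ?_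
    rintro rfl
    rw [hux] at ha
    norm_num at ha

variable [MeasurableSpace α]

theorem measurable_projDeviation (hg : Measurable g) (hu : Measurable u) (hDu : Measurable Du)
    {β : Type*} [MeasurableSpace β] {X : β → α} {b : β → Euc N} {ζ : β → EucMat N n}
    {a : β → Euc N} (hX : Measurable X) (hb : Measurable b) (hζ : Measurable ζ)
    (ha : Measurable a) :
    Measurable fun z => projDeviation p g u Du (X z) (b z) (ζ z) (a z) := by
  unfold projDeviation deviation
  have h1 : Measurable fun z => regProj 0 (b z - a z) :=
    measurable_regProj_zero.comp (hb.sub ha)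
  have h2 : Measurable fun z => radGrad (b z - a z) (ζ z) := measurable_radGrad (hb.sub ha) hζ
  have h3 := (((h1.sub (hu.comp hX)).norm.pow_const p).add
    ((h2.sub (hDu.comp hX)).norm.pow_const p)).add
    ((hg.comp (hX.prodMk h2)).sub (hg.comp (hX.prodMk (hDu.comp hX)))).norm
  exact h3.ennreal_ofReal

/-- At `a = 0` the deviation of `u` from itself vanishes, by `htan`; `hnear` supplies the integrable
majorant that turns continuity at `a = 0` into convergence of the integrals. -/
theorem tendsto_lintegral_projDeviation_center {ν : Measure α} [IsFiniteMeasure ν] (hp : 0 < p)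
    (hg : Measurable g) (hum : Measurable u) (hDum : Measurable Du)
    (hlow : ∀ᵐ x ∂ν, ∀ ζ, ‖ζ‖ ^ p ≤ g (x, ζ)) (hu : ∀ᵐ x ∂ν, ‖u x‖ = 1)
    (hcont : ∀ᵐ x ∂ν, Continuous fun ζ => g (x, ζ)) {δ c : ℝ} (hδ : 0 < δ)
    (hnear : ∀ᵐ x ∂ν, ∀ a, ‖a‖ ≤ δ → g (x, radGrad (u x - a) (Du x)) ≤ c * (1 + g (x, Du x)))
    (htan : ∀ᵐ x ∂ν, radGrad (u x) (Du x) = Du x)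
    (hint : Integrable (fun x => g (x, Du x)) ν) :
    Tendsto (fun a => ∫⁻ x, projDeviation p g u Du x (u x) (Du x) a ∂ν) (𝓝 0) (𝓝 0) := by
  have hz : ∫⁻ _x : α, 0 ∂ν = 0 := by simp
  rw [← hz]
  have hi : Integrable (fun x => (2 ^ p + 1) * (1 + c) * (1 + g (x, Du x))) ν :=
    ((integrable_const 1).add hint).const_mul _
  refine tendsto_lintegral_filter_of_dominated_convergence
    (fun x => ENNReal.ofReal ((2 ^ p + 1) * (1 + c) * (1 + g (x, Du x)))) ?_ ?_ ?_ ?_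
  · exact Eventually.of_forall fun a =>
      measurable_projDeviation hg hum hDum measurable_id hum hDum measurable_const
  · filter_upwards [Metric.closedBall_mem_nhds (0 : Euc N) hδ] with a ha
    filter_upwards [hlow, hu, hnear] with x h1 h2 h3
    refine ENNReal.ofReal_le_ofReal ((deviation_le hp.le h1 h2 (norm_regProj_le _ _) _).trans ?_)
    have h4 := h3 a (mem_closedBall_zero_iff.1 ha)
    rw [mul_assoc]
    refine mul_le_mul_of_nonneg_left ?_ (by positivity)
    linarith
  · exact (hi.lintegral_lt_top).ne
  · filter_upwards [hu, hcont, htan] with x h1 h2 h3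
    have hne : u x ≠ 0 := fun h => by simp [h] at h1
    have h4 := tendsto_projDeviation (p := p) (u := u) (Du := Du) (x := x) hp h2
      (tendsto_const_nhds (x := u x)) (tendsto_const_nhds (x := Du x))
      (tendsto_id (x := 𝓝 (0 : Euc N))) hne
    have h5 : projDeviation p g u Du x (u x) (Du x) 0 = 0 := by
      simp [projDeviation, deviation, regProj, h1, h3, Real.zero_rpow hp.ne']
    rw [h5] at h4
    exact h4

/-- Existence of good centres of projection near the origin. -/
theorem exists_center_lintegral_lt {ν : Measure α} [IsFiniteMeasure ν] (hp : 0 < p)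
    (hg : Measurable g) (hum : Measurable u) (hDum : Measurable Du)
    (hlow : ∀ᵐ x ∂ν, ∀ ζ, ‖ζ‖ ^ p ≤ g (x, ζ)) (hu : ∀ᵐ x ∂ν, ‖u x‖ = 1)
    (hcont : ∀ᵐ x ∂ν, Continuous fun ζ => g (x, ζ)) {δ c K : ℝ} (hδ : 0 < δ)
    (hK : 0 ≤ K)
    (hnear : ∀ᵐ x ∂ν, ∀ a, ‖a‖ ≤ δ → g (x, radGrad (u x - a) (Du x)) ≤ c * (1 + g (x, Du x)))
    (htan : ∀ᵐ x ∂ν, radGrad (u x) (Du x) = Du x)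
    (havg : ∀ᵐ x ∂ν, ∀ (b : Euc N) (ζ : EucMat N n),
      ∫⁻ a in Metric.ball (0 : Euc N) (1 / 2), ENNReal.ofReal (g (x, radGrad (b - a) ζ))
        ≤ ENNReal.ofReal (K * (g (x, ζ) + 1)))
    (hint : Integrable (fun x => g (x, Du x)) ν)
    {uj : ℕ → α → Euc N} {Duj : ℕ → α → EucMat N n} (hujm : ∀ j, Measurable (uj j))
    (hDujm : ∀ j, Measurable (Duj j))
    (huj : ∀ᵐ x ∂ν, Tendsto (fun j => uj j x) atTop (𝓝 (u x)))
    (hDuj : ∀ᵐ x ∂ν, Tendsto (fun j => Duj j x) atTop (𝓝 (Du x)))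
    (hL1 : Tendsto (fun j => ∫⁻ x, ‖g (x, Duj j x) - g (x, Du x)‖ₑ ∂ν) atTop (𝓝 0))
    {P : ℕ → Euc N → Prop}
    (hP : ∀ j, ∀ᵐ a ∂volume.restrict (Metric.ball (0 : Euc N) (1 / 2)), P j a)
    {ε : ℝ≥0∞} (hε : 0 < ε) (hε' : ε ≠ ⊤) :
    ∃ j a, P j a ∧ ∫⁻ x, projDeviation p g u Du x (uj j x) (Duj j x) a ∂ν < ε := by
  have h1 := tendsto_lintegral_projDeviation_center hp hg hum hDum hlow hu hcont hδ hnear htan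
    hint
  obtain ⟨r, hr, hrb⟩ := Metric.eventually_nhds_iff_ball.1
    (h1.eventually_lt_const (ENNReal.half_pos hε.ne'))
  -- Radius `r` makes the deviation of `u` less than `ε / 2` for every centre in the ball; `1 / 4`
  -- keeps the centres away from the unit sphere.
  set ρ := min r (1 / 4) with hρ
  have hρ0 : 0 < ρ := lt_min hr (by norm_num)
  have hρ4 : ρ ≤ 1 / 4 := min_le_right _ _
  set V := volume (Metric.ball (0 : Euc N) ρ) with hV
  have hV0 : V ≠ 0 := (Metric.measure_ball_pos _ _ hρ0).ne'
  have hVt : V ≠ ⊤ := measure_ball_lt_top.ne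
  have hmeas : ∀ {b : α → Euc N} {ζ : α → EucMat N n}, Measurable b → Measurable ζ →
      Measurable (Function.uncurry fun (x : α) (a : Euc N) =>
        projDeviation p g u Du x (b x) (ζ x) a) := fun hb hζ =>
    measurable_projDeviation hg hum hDum measurable_fst (hb.comp measurable_fst)
      (hζ.comp measurable_fst) measurable_snd
  have hlim : ∫⁻ x, (∫⁻ a in Metric.ball (0 : Euc N) ρ, projDeviation p g u Du x (u x) (Du x) a) ∂ν
      < ε * V := by
    rw [lintegral_lintegral_swap (hmeas hum hDum).aemeasurable]
    calc _ ≤ ∫⁻ _a in Metric.ball (0 : Euc N) ρ, ε / 2 :=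
          setLIntegral_mono' measurableSet_ball fun a ha =>
            (hrb a (Metric.ball_subset_ball (min_le_left _ _) ha)).le
      _ = ε / 2 * V := setLIntegral_const _ _
      _ < ε * V := ENNReal.mul_lt_mul_left hV0 hVt (ENNReal.half_lt_self hε.ne' hε')
  have hbound : ∀ᵐ x ∂ν, ∀ (b : Euc N) (ζ : EucMat N n), _ :=
    (hlow.and (hu.and (hcont.and havg))).mono fun x hx =>
      lintegral_projDeviation_le (Du := Du) hp.le hx.1 hx.2.1 hK (hρ4.trans (by norm_num)) hx.2.2.1
        hx.2.2.2
  have hEl : Tendsto (fun j => ∫⁻ x, ENNReal.ofReal ((2 ^ p + 1) * K)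
      * ‖g (x, Duj j x) - g (x, Du x)‖ₑ ∂ν) atTop (𝓝 0) := by
    have := ENNReal.Tendsto.const_mul (a := ENNReal.ofReal ((2 ^ p + 1) * K)) hL1
      (Or.inr ENNReal.ofReal_ne_top)
    rw [mul_zero] at this
    simpa only [← lintegral_const_mul' _ _ (ENNReal.ofReal_ne_top (r := (2 ^ p + 1) * K))] using this
  have hi : Integrable (fun x => 1 + g (x, Du x)) ν := (integrable_const 1).add hint
  have hgm : Measurable fun x => g (x, Du x) := hg.comp (measurable_id.prodMk hDum)
  have hev := eventually_lintegral_lt_of_dominated (ν := ν)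
    (F := fun j x => ∫⁻ a in Metric.ball (0 : Euc N) ρ,
      projDeviation p g u Du x (uj j x) (Duj j x) a)
    (fun j => (hmeas (hujm j) (hDujm j)).lintegral_prod_right'.aemeasurable)
    (((measurable_const.add hgm).ennreal_ofReal.const_mul (ENNReal.ofReal (2 ^ p + 1) * V
          + ENNReal.ofReal ((2 ^ p + 1) * K))).aemeasurable)
    (by
      rw [lintegral_const_mul _ (measurable_const.add hgm).ennreal_ofReal]
      exact ENNReal.mul_ne_top (ENNReal.add_ne_top.2 ⟨ENNReal.mul_ne_top ENNReal.ofReal_ne_top hVt,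
        ENNReal.ofReal_ne_top⟩) hi.lintegral_lt_top.ne)
    hEl (fun j => hbound.mono fun x hx => hx _ _)
    (F' := fun x => ∫⁻ a in Metric.ball (0 : Euc N) ρ, projDeviation p g u Du x (u x) (Du x) a)
    (hbound.mono fun x hx => by simpa using hx (u x) (Du x))
    (by
      filter_upwards [hlow, hu, hcont, huj, hDuj] with x a1 a2 a3 a4 a5
      exact tendsto_lintegral_projDeviation hp a1 a2 a3 hρ4 a4 a5)
    hlim
  obtain ⟨j, hj⟩ := hev.exists
  rw [lintegral_lintegral_swap (hmeas (hujm j) (hDujm j)).aemeasurable] at hj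
  refine ⟨j, ?_⟩
  -- If almost every centre in the ball had deviation at least `ε`, the averaged deviation would be
  -- at least `ε * V`.
  by_contra hcon
  push Not at hcon
  refine hj.not_ge ?_
  rw [← setLIntegral_const]
  refine lintegral_mono_ae ?_
  filter_upwards [ae_restrict_of_ae_restrict_of_subset
    (Metric.ball_subset_ball (hρ4.trans (by norm_num))) (hP j)] with a ha
  exact hcon a ha

end

/-! ### Sphere-valued approximation -/

theorem radGrad_eq_self {n N : ℕ} {y : Euc N} {ζ : EucMat N n} (hy : ‖y‖ = 1)
    (h : ∀ k, inner ℝ y (matCol ζ k) = 0) : radGrad y ζ = ζ := by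
  ext z
  simp [radGrad, regDeriv_apply, hy, h]

theorem IntegrandAssumptions.nonneg {n N : ℕ} {p q C μ σ : ℝ} {Ω : Set (Euc n)}
    {f : Euc n → EucMat N n → ℝ} (hf : IntegrandAssumptions p q C μ σ Ω f) {x : Euc n}
    (hx : x ∈ Ω) (ζ : EucMat N n) : 0 ≤ f x ζ :=
  (Real.rpow_nonneg (norm_nonneg ζ) p).trans (hf.lower_growth x hx ζ)

theorem IntegrandAssumptions.monotone {n N : ℕ} {p q C μ σ : ℝ} {Ω : Set (Euc n)}
    {f : Euc n → EucMat N n → ℝ} (hf : IntegrandAssumptions p q C μ σ Ω f) {x : Euc n}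
    (hx : x ∈ Ω) (ξ η : EucMat N n) :
    0 ≤ inner ℝ (gradient (f x) ξ - gradient (f x) η) (ξ - η) := by
  refine le_trans ?_ (hf.strongly_monotone x hx ξ η)
  have := hf.one_le_C
  positivity

/-- Applies `exists_pointwise_bound_of_average` to `f x`, with the average taken for the value `0`.
In the constant, `C` bounds `f x 0` and `κ * K` comes from the average. -/
theorem IntegrandAssumptions.exists_near_bound {n N : ℕ} (hN : 2 ≤ N) {p q C μ σ : ℝ}
    (hq : 0 < q) {Ω : Set (Euc n)} (hΩ : IsOpen Ω)
    {f : Euc n → EucMat N n → ℝ} (hf : IntegrandAssumptions p q C μ σ Ω f) {K : ℝ} (hK : 0 ≤ K)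
    (havg : ∀ᵐ x ∂volume.restrict Ω, ∀ (b : Euc N) (ζ : EucMat N n),
      ∫⁻ a in Metric.ball (0 : Euc N) (1 / 2), ENNReal.ofReal (f x (radGrad (b - a) ζ))
        ≤ ENNReal.ofReal (K * (f x ζ + 1))) :
    ∃ δ : ℝ, 0 < δ ∧ ∃ c : ℝ, ∀ᵐ x ∂volume.restrict Ω, ∀ (b : Euc N) (ζ : EucMat N n), ‖b‖ = 1 →
      (∀ k, inner ℝ b (matCol ζ k) = 0) → ∀ a : Euc N, ‖a‖ ≤ δ →
        f x (radGrad (b - a) ζ) ≤ c * (1 + f x ζ) := by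
  obtain ⟨δ, hδ, -, κ, hκ, hb⟩ := exists_pointwise_bound_of_average (n := n) hN
  refine ⟨δ, hδ, C + κ * K, ?_⟩
  filter_upwards [havg, ae_restrict_mem hΩ.measurableSet] with x hx hxΩ b ζ hb1 hbζ a ha
  have h0 := hf.nonneg hxΩ
  have h1 := hb (f x) (hf.contDiff x hxΩ) (hf.monotone hxΩ) h0 ζ (K * (f x ζ + 1))
    (mul_nonneg hK (by linarith [h0 ζ])) (hx 0 ζ) b hb1 hbζ a ha
  have h2 := hf.upper_growth x hxΩ 0
  rw [norm_zero, Real.zero_rpow hq.ne', zero_add, mul_one] at h2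
  have h3 : C * 1 ≤ C * (1 + f x ζ) :=
    mul_le_mul_of_nonneg_left (by linarith [h0 ζ]) (by linarith [hf.one_le_C])
  linarith

theorem exists_subseq_ae_tendsto {α E F : Type*} [MeasurableSpace α] {ν : Measure α}
    [NormedAddCommGroup E] [NormedAddCommGroup F] {p : ℝ≥0∞} (hp : p ≠ 0)
    {v : ℕ → α → E} {v' : α → E} {w : ℕ → α → F} {w' : α → F}
    (hv : ∀ j, AEStronglyMeasurable (v j) ν) (hv' : AEStronglyMeasurable v' ν)
    (hw : ∀ j, AEStronglyMeasurable (w j) ν) (hw' : AEStronglyMeasurable w' ν)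
    (h1 : Tendsto (fun j => eLpNorm (v j - v') p ν) atTop (𝓝 0))
    (h2 : Tendsto (fun j => eLpNorm (w j - w') p ν) atTop (𝓝 0)) :
    ∃ s : ℕ → ℕ, StrictMono s ∧ (∀ᵐ x ∂ν, Tendsto (fun j => v (s j) x) atTop (𝓝 (v' x))) ∧
      ∀ᵐ x ∂ν, Tendsto (fun j => w (s j) x) atTop (𝓝 (w' x)) := by
  obtain ⟨s, hs, hsv⟩ :=
    (tendstoInMeasure_of_tendsto_eLpNorm hp hv hv' h1).exists_seq_tendsto_ae
  obtain ⟨t, ht, htw⟩ := (tendstoInMeasure_of_tendsto_eLpNorm hp (fun j => hw (s j)) hw'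
    (h2.comp hs.tendsto_atTop)).exists_seq_tendsto_ae
  refine ⟨s ∘ t, hs.comp ht, ?_, htw⟩
  filter_upwards [hsv] with x hx
  exact hx.comp ht.tendsto_atTop

theorem eLpNorm_le_of_lintegral_rpow_le {α E : Type*} [MeasurableSpace α] {ν : Measure α}
    [NormedAddCommGroup E] {p : ℝ} (hp : 0 < p) {v : α → E} {H : α → ℝ≥0∞} {ε : ℝ≥0∞}
    (h : ∀ᵐ x ∂ν, ENNReal.ofReal (‖v x‖ ^ p) ≤ H x) (hH : ∫⁻ x, H x ∂ν ≤ ε) :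
    eLpNorm v (ENNReal.ofReal p) ν ≤ ε ^ (1 / p) := by
  rw [eLpNorm_eq_lintegral_rpow_enorm_toReal (by simpa using hp) ENNReal.ofReal_ne_top,
    ENNReal.toReal_ofReal hp.le]
  refine ENNReal.rpow_le_rpow ((lintegral_mono_ae ?_).trans hH) (by positivity)
  filter_upwards [h] with x hx
  rwa [← ofReal_norm, ENNReal.ofReal_rpow_of_nonneg (norm_nonneg _) hp.le]

/-- Approximation by one sphere-valued Sobolev map up to a given error. -/
theorem exists_sphere_approximation {n N : ℕ} (hN : 2 ≤ N) {p q C μ σ : ℝ}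
    (hp : 2 ≤ p) (hpq : p < q) (hqN : q < N)
    {Ω : Set (Euc n)} (hΩ : IsOpen Ω) (hΩb : Bornology.IsBounded Ω)
    {f : Euc n → EucMat N n → ℝ} (hf : IntegrandAssumptions p q C μ σ Ω f)
    {U : Set (Euc n)} (hU : IsOpen U) (hUΩ : U ⊆ Ω)
    {u : Euc n → Euc N} {Du : Euc n → EucMat N n} (hu : MemW1pSphere p U u Du)
    {uj : ℕ → Euc n → Euc N} {Duj : ℕ → Euc n → EucMat N n}
    (huj : ∀ j, MemW1p q U (uj j) (Duj j)) (hconv : TendstoW1p p U uj Duj u Du)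
    (hfconv : TendstoL1 U (fun j x => f x (Duj j x)) (fun x => f x (Du x)))
    {ε : ℝ≥0∞} (hε : 0 < ε) (hε' : ε ≠ ⊤) :
    ∃ (v : Euc n → Euc N) (Dv : Euc n → EucMat N n), MemW1pSphere q U v Dv ∧
      IntegrableOn (fun x => f x (Dv x)) U volume ∧
      eLpNorm (v - u) (ENNReal.ofReal p) (volume.restrict U) ≤ ε ^ (1 / p) ∧
      eLpNorm (Dv - Du) (ENNReal.ofReal p) (volume.restrict U) ≤ ε ^ (1 / p) ∧
      eLpNorm ((fun x => f x (Dv x)) - fun x => f x (Du x)) 1 (volume.restrict U) ≤ ε := by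
  have hp0 : 0 < p := by linarith
  have hq0 : 0 < q := by linarith
  set ν := volume.restrict U with hν
  have hνΩ : ν ≤ volume.restrict Ω := Measure.restrict_mono hUΩ le_rfl
  have hUb : Bornology.IsBounded U := hΩb.subset hUΩ
  have hfin : IsFiniteMeasure ν := ⟨by simpa [hν] using hUb.measure_lt_top⟩
  obtain ⟨K, hK, havg⟩ := hf.averaged_projection.pointwise (by linarith) (by linarith) hΩ hΩb
    hf.caratheodory.2
  obtain ⟨δ, hδ, c, hnear⟩ := hf.exists_near_bound hN hq0 hΩ hK.le havg
  obtain ⟨g, hgm, hfg⟩ := hf.caratheodory.exists_measurable hΩ.measurableSet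
  obtain ⟨u', Du', hum, hDum, huu', hDuu', hu'⟩ := hu.1.exists_measurable
  choose uj' Duj' hujm hDujm hujj hDujj huj' using fun j => (huj j).exists_measurable
  replace havg := ae_mono hνΩ havg
  replace hnear := ae_mono hνΩ hnear
  replace hfg := ae_mono hνΩ hfg
  have hmem : ∀ᵐ x ∂ν, x ∈ Ω := ae_mono hνΩ (ae_restrict_mem hΩ.measurableSet)
  have hnorm : ∀ᵐ x ∂ν, ‖u' x‖ = 1 := by
    filter_upwards [hu.2, huu'] with x h1 h2
    rw [← h2]; simpa using h1
  have horth := hu'.2.2.inner_matCol_eq_zero hU hnorm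
  -- Only one index has to be found for the given `ε`, so passing to an almost everywhere convergent
  -- subsequence loses nothing.
  obtain ⟨s, hs, hsu, hsDu⟩ := exists_subseq_ae_tendsto (by simpa using hp0)
    (fun j => (hconv.1 j).1.1) hu.1.1.1 (fun j => (hconv.1 j).2.1.1) hu.1.2.1.1
    hconv.2.2.1 hconv.2.2.2
  have hint : Integrable (fun x => g (x, Du' x)) ν := by
    refine hfconv.2.1.congr ?_
    filter_upwards [hfg, hDuu'] with x h1 h2
    rw [h1, h2]
  have hL1 : Tendsto (fun j => ∫⁻ x, ‖g (x, Duj' (s j) x) - g (x, Du' x)‖ₑ ∂ν) atTop (𝓝 0) := by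
    refine (hfconv.2.2.comp hs.tendsto_atTop).congr fun j => ?_
    rw [Function.comp_apply, eLpNorm_one_eq_lintegral_enorm]
    refine lintegral_congr_ae ?_
    filter_upwards [hfg, hDuu', hDujj (s j)] with x h1 h2 h3
    rw [Pi.sub_apply, h1, h1, h2, h3]
  -- The side condition on the centre is that the projection avoids its singularity almost
  -- everywhere and has a weak gradient in `L^q`; it holds for almost every centre, so it survives
  -- the selection.
  obtain ⟨j, a, ⟨hne, hDvq, hgrad⟩, hlt⟩ := exists_center_lintegral_lt (ν := ν) (p := p) (g := g)
    (u := u') (Du := Du') (δ := δ) (c := c) (K := K) hp0 hgm hum hDum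
    (by
      filter_upwards [hfg, hmem] with x h1 h2 ζ
      rw [← h1]; exact hf.lower_growth x h2 ζ)
    hnorm
    (by
      filter_upwards [hfg, hmem] with x h1 h2
      simpa only [← h1] using hf.caratheodory.2 x h2)
    hδ hK.le
    (by
      filter_upwards [hfg, hnear, hnorm, horth] with x h1 h2 h3 h4 a ha
      rw [← h1, ← h1]
      exact h2 _ _ h3 h4 a ha)
    (by
      filter_upwards [hnorm, horth] with x h1 h2
      exact radGrad_eq_self h1 h2)
    (by
      filter_upwards [hfg, havg] with x h1 h2
      simpa only [← h1] using h2)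
    hint (uj := fun j => uj' (s j)) (Duj := fun j => Duj' (s j)) (fun j => hujm _)
    (fun j => hDujm _)
    (by
      filter_upwards [hsu, huu', ae_all_iff.2 hujj] with x h1 h2 h3
      simpa only [h2, h3] using h1)
    (by
      filter_upwards [hsDu, hDuu', ae_all_iff.2 hDujj] with x h1 h2 h3
      simpa only [h2, h3] using h1)
    hL1
    (fun j => ae_hasWeakGrad_radialProj (by linarith) hqN hU hUb (hujm (s j)) (hDujm (s j))
      (huj' (s j)).2.1 (huj' (s j)).2.2)
    hε hε'
  set w := uj' (s j)
  set Dv : Euc n → EucMat N n := fun x => radGrad (w x - a) (Duj' (s j) x) with hDv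
  have hDvm : Measurable Dv := measurable_radGrad ((hujm _).sub_const a) (hDujm _)
  have hterm : ∀ x, ENNReal.ofReal (‖radialProj w a x - u' x‖ ^ p)
        ≤ projDeviation p g u' Du' x (w x) (Duj' (s j) x) a ∧
      ENNReal.ofReal (‖Dv x - Du' x‖ ^ p)
        ≤ projDeviation p g u' Du' x (w x) (Duj' (s j) x) a ∧
      ENNReal.ofReal |g (x, Dv x) - g (x, Du' x)|
        ≤ projDeviation p g u' Du' x (w x) (Duj' (s j) x) a := by
    intro x
    have h1 := Real.rpow_nonneg (norm_nonneg (radialProj w a x - u' x)) p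
    have h2 := Real.rpow_nonneg (norm_nonneg (Dv x - Du' x)) p
    have h3 := abs_nonneg (g (x, Dv x) - g (x, Du' x))
    have h4 : projDeviation p g u' Du' x (w x) (Duj' (s j) x) a
        = ENNReal.ofReal (‖radialProj w a x - u' x‖ ^ p + ‖Dv x - Du' x‖ ^ p
          + |g (x, Dv x) - g (x, Du' x)|) := by
      rw [radialProj_eq]; rfl
    rw [h4]
    exact ⟨ENNReal.ofReal_le_ofReal (by linarith), ENNReal.ofReal_le_ofReal (by linarith),
      ENNReal.ofReal_le_ofReal (by linarith)⟩
  have hvm : AEStronglyMeasurable (radialProj w a) ν :=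
    ((((hujm (s j)).sub_const a).norm.inv).smul ((hujm (s j)).sub_const a)).aestronglyMeasurable
  have hdiff : ∫⁻ x, ‖f x (Dv x) - f x (Du x)‖ₑ ∂ν ≤ ε := by
    refine (lintegral_mono_ae ?_).trans hlt.le
    filter_upwards [hfg, hDuu'] with x h1 h2
    rw [h1, h1, h2, ← ofReal_norm]
    exact (hterm x).2.2
  have hfDvm : AEStronglyMeasurable (fun x => f x (Dv x)) ν := by
    refine ((hgm.comp (measurable_id.prodMk hDvm)).aestronglyMeasurable).congr ?_
    filter_upwards [hfg] with x h1
    rw [h1]; rfl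
  -- Integrability comes from the finite deviation from `f(x, Du)`; the `q`-growth is not needed for
  -- it.
  have hfDv : Integrable (fun x => f x (Dv x)) ν := by
    have h1 : Integrable (fun x => f x (Dv x) - f x (Du x)) ν :=
      ⟨hfDvm.sub hfconv.2.1.1, hdiff.trans_lt hε'.lt_top⟩
    refine (h1.add hfconv.2.1).congr (Eventually.of_forall fun x => ?_)
    exact sub_add_cancel _ _
  refine ⟨radialProj w a, Dv, ⟨⟨?_, hDvq, hgrad⟩, ?_⟩, hfDv, ?_, ?_, ?_⟩
  · refine MemLp.of_bound hvm 1 (Eventually.of_forall fun x => ?_)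
    rw [radialProj_eq]
    exact norm_regProj_le _ _
  · filter_upwards [hne] with x hx
    rw [mem_sphere_zero_iff_norm, radialProj, norm_smul, norm_inv, norm_norm]
    exact inv_mul_cancel₀ (norm_ne_zero_iff.2 (sub_ne_zero.2 hx))
  · refine eLpNorm_le_of_lintegral_rpow_le hp0 ?_ hlt.le
    filter_upwards [huu'] with x hx
    rw [Pi.sub_apply, hx]
    exact (hterm x).1
  · refine eLpNorm_le_of_lintegral_rpow_le hp0 ?_ hlt.le
    filter_upwards [hDuu'] with x hx
    rw [Pi.sub_apply, hx]
    exact (hterm x).2.1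
  · rw [eLpNorm_one_eq_lintegral_enorm]
    exact hdiff

theorem mainTheorem3 {n N : ℕ} (hn : 2 ≤ n) (hN : 4 ≤ N) {p q C μ σ : ℝ}
    (hp : 2 ≤ p) (hpq : p < q) (hqN : q < N)
    {Ω : Set (Euc n)} (hΩ : IsOpen Ω) (hΩb : Bornology.IsBounded Ω)
    {f : Euc n → EucMat N n → ℝ} (hf : IntegrandAssumptions p q C μ σ Ω f)
    {x₀ : Euc n} {R : ℝ} (hR : 0 < R) (hball : Metric.closedBall x₀ R ⊆ Ω)
    (u : Euc n → Euc N) (Du : Euc n → EucMat N n)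
    (hu : MemW1pSphere p (Metric.ball x₀ R) u Du)
    (uj : ℕ → Euc n → Euc N) (Duj : ℕ → Euc n → EucMat N n)
    (huj : ∀ j, MemW1p q (Metric.ball x₀ R) (uj j) (Duj j))
    (hconv : TendstoW1p p (Metric.ball x₀ R) uj Duj u Du)
    (hfconv : TendstoL1 (Metric.ball x₀ R) (fun j x => f x (Duj j x)) (fun x => f x (Du x))) :
    ∃ (vj : ℕ → Euc n → Euc N) (Dvj : ℕ → Euc n → EucMat N n),
      (∀ j, MemW1pSphere q (Metric.ball x₀ R) (vj j) (Dvj j)) ∧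
      TendstoW1p p (Metric.ball x₀ R) vj Dvj u Du ∧
      TendstoL1 (Metric.ball x₀ R) (fun j x => f x (Dvj j x)) (fun x => f x (Du x)) := by
  have hp0 : 0 < p := by linarith
  have hfin : IsFiniteMeasure (volume.restrict (Metric.ball x₀ R)) :=
    ⟨by simpa using measure_ball_lt_top⟩
  choose vj Dvj h1 h2 h3 h4 h5 using fun j : ℕ => exists_sphere_approximation (by omega) hp hpq hqN
    hΩ hΩb hf Metric.isOpen_ball (Metric.ball_subset_closedBall.trans hball) hu huj hconv hfconv
    (ε := ((j : ℝ≥0∞) + 1)⁻¹) (by simp) (by simp)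
  have hε : Tendsto (fun j : ℕ => ((j : ℝ≥0∞) + 1)⁻¹) atTop (𝓝 0) := by
    have := ENNReal.tendsto_inv_nat_nhds_zero.comp (tendsto_add_atTop_nat 1)
    simpa [Function.comp_def] using this
  have hεp : Tendsto (fun j : ℕ => (((j : ℝ≥0∞) + 1)⁻¹) ^ (1 / p)) atTop (𝓝 0) := by
    have := ((ENNReal.continuous_rpow_const (y := 1 / p)).tendsto 0).comp hε
    rw [ENNReal.zero_rpow_of_pos (by positivity)] at this
    exact this
  have hle : ENNReal.ofReal p ≤ ENNReal.ofReal q := ENNReal.ofReal_le_ofReal hpq.le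
  refine ⟨vj, Dvj, h1, ⟨fun j => ⟨(h1 j).1.1.mono_exponent hle, (h1 j).1.2.1.mono_exponent hle,
    (h1 j).1.2.2⟩, hu.1, ?_, ?_⟩, h2, hfconv.2.1, ?_⟩
  · exact tendsto_of_tendsto_of_tendsto_of_le_of_le tendsto_const_nhds hεp (fun _ => zero_le) h3
  · exact tendsto_of_tendsto_of_tendsto_of_le_of_le tendsto_const_nhds hεp (fun _ => zero_le) h4
  · exact tendsto_of_tendsto_of_tendsto_of_le_of_le tendsto_const_nhds hε (fun _ => zero_le) h5
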